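/- **Setting.** Let $f,\theta_1,\dots,\theta_s\in\mathbb R[\mathbf y]$ with $\mathbf y=(y_1,\dots,y_\ell)$, let $G$ be a non-constant symmetric $q\times q$ matrix of polynomials in $\mathbf x=(x_1,\dots,x_n)$, and let $P(\mathbf y,\mathbf x)=\sum_{\beta}P_\beta(\mathbf x)\mathbf y^\beta$ be a symmetric $m\times m$ matrix of polynomials in $(\mathbf y,\mathbf x)$. Put $$\mathcal Y=\{\mathbf y\in\mathbb R^\ell\mid\theta_j(\mathbf y)\ge 0,\ j=1,\dots,s\},\qquad \mathcal X=\{\mathbf x\in\mathbb R^n\mid G(\mathbf x)\succeq 0\},$$ $$f^\star=\inf\{f(\mathbf y)\mid \mathbf y\in\mathcal Y,\ P(\mathbf y,\mathbf x)\succeq 0\ \ \forall \mathbf x\in\mathcal X\}, \tag{RPMIO}$$ and assume that (RPMIO) has an optimal solution. The degree of a polynomial matrix is the largest degree of an entry. Put $d_G=\lceil\deg (G)/2\rceil$, $k_{\mathbf y}=\max\{\deg f,\deg\theta_j,\deg_{\mathbf y}P_{ij}\}$ and $k_{\mathbf x}=\max\{\deg_{\mathbf x}P_{ij},\deg G\}$.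 A polynomial matrix $\Sigma$ is *SOS* if $\Sigma=T^{\mathsf T}T$ for some polynomial matrix $T$. For $A\in\mathbb R[\mathbf x]^{mq\times mq}$ and $B\in\mathbb R[\mathbf x]^{q\times q}$, $(A,B)_m$ is the $m\times m$ matrix of the traces of the $q\times q$ blocks of $A^{\mathsf T}(I_m\otimes B)$. Let $\mathcal Q^m_k(G)$ be the set of all $\Sigma_0+(\Sigma_1,G)_m$ with $\Sigma_0$ ($m\times m$) and $\Sigma_1$ ($mq\times mq$) SOS and $\deg\Sigma_0,\ \deg(\Sigma_1,G)_m\le 2k$. For a sequence $\mathbf S=(S_\alpha)_{|\alpha|\le 2k}$ of real symmetric $m\times m$ matrices, $M_d(\mathbf S)=(S_{\alpha+\beta})_{|\alpha|,|\beta|\le d}$ is its moment matrix and $M_d(G\mathbf S)=\bigl(\sum_\gamma S_{\alpha+\beta+\gamma}\otimes G_\gamma\bigr)_{|\alpha|,|\beta|\le d}$ its localizing matrix. For $k\ge d_G$, $\mathcal M^m_k(G)$ is the set of such $\mathbf S$ with $M_k(\mathbf S)\succeq0$ and $M_{k-d_G}(G\mathbf S)\succeq0$. For $\Theta=\{\theta_1,\dots,\theta_s\}$,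 $\mathcal Q_k(\Theta)$ and $\mathcal M_k(\Theta)$ denote $\mathcal Q^1_k$ and $\mathcal M^1_k$ of $\mathrm{diag}(\theta_1,\dots,\theta_s)$, in the variables $\mathbf y$. Put $\mathscr L_{\mathbf S}(F)=\sum_\alpha\mathrm{tr}(F_\alpha S_\alpha)$, $\mathscr L_{\mathbf S}(P)=\sum_\beta\mathscr L_{\mathbf S}(P_\beta)\mathbf y^\beta$, $\mathscr H_{\mathbf s}(h)=\sum_\alpha h_\alpha s_\alpha$ and $\mathscr H_{\mathbf s}(P)=\sum_\beta s_\beta P_\beta(\mathbf x)$. For $k\ge\lceil k_{\mathbf x}/2\rceil$ consider $$f_k^{\mathrm{primal}}=\sup_{\rho\in\mathbb R,\ \mathbf S}\bigl\{\rho\mid f-\rho-\mathscr L_{\mathbf S}(P)\in\mathcal Q_{\lceil k_{\mathbf y}/2\rceil}(\Theta),\ \mathbf S\in\mathcal M^m_k(G)\bigr\},$$ $$f_k^{\mathrm{dual}}=\inf_{\mathbf s}\bigl\{\mathscr H_{\mathbf s}(f)\mid \mathbf s\in\mathcal M_{\lceil k_{\mathbf y}/2\rceil}(\Theta),\ \mathscr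 H_{\mathbf s}(1)=1,\ \mathscr H_{\mathbf s}(P)\in\mathcal Q^m_k(G)\bigr\}.$$ *Assumption 1.* $f,-\theta_1,\dots,-\theta_s$ are SOS-convex (their Hessians are SOS matrices); for every $\mathbf x\in\mathcal X$, $-P(\cdot,\mathbf x)$ is PSD-SOS-convex ($-\mathbf v^{\mathsf T}P(\cdot,\mathbf x)\mathbf v$ is SOS-convex for every $\mathbf v\in\mathbb R^m$); $\mathcal X$ is compact. *Assumption 3 (Slater).* There is $\bar{\mathbf y}$ with $\theta_j(\bar{\mathbf y})>0$ for all $j$ and $P(\bar{\mathbf y},\mathbf x)\succ0$ for all $\mathbf x\in\mathcal X$. **Theorem.** Let $(f_k^{\mathrm{primal}},\mathbf S^\star)$ be an optimal solution of the primal relaxation of order $k$, and suppose that for some $t$ with $\lceil k_{\mathbf x}/2\rceil\le t\le k$ the flat extension condition $$\operatorname{rank}M_t(\mathbf S^\star)=\operatorname{rank}M_{t-d_G}(\mathbf S^\star)$$ holds. Then: (i) The truncation $(S^\star_\alpha)_{|\alpha|\le 2t}$ has a finitely atomic PSD matrix-valued representing measure on $\mathcal X$: there are distinct points $\mathbf x^{(1)},\dots,\mathbf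 x^{(r)}\in\mathcal X$ and PSD matrices $W_1,\dots,W_r$ such that, with $\Phi^\star=\sum_{i=1}^rW_i\delta_{\mathbf x^{(i)}}$, $S^\star_\alpha=\int_{\mathcal X}\mathbf x^\alpha\,d\Phi^\star(\mathbf x)$ for all $|\alpha|\le 2t$. (ii) $f_k^{\mathrm{primal}}\le f^\star$, with equality if Assumptions 1 and 3 hold. If moreover Assumptions 1 and 3 hold and $f_k^{\mathrm{primal}}=f_k^{\mathrm{dual}}$, then $f_k^{\mathrm{primal}}=f_k^{\mathrm{dual}}=f^\star$, and for every optimal solution $\mathbf s^\star$ of the dual relaxation of order $k$: (iii) $\mathbf s^\star_{\mathbf e}=(s^\star_{\mathbf e_1},\dots,s^\star_{\mathbf e_\ell})$ is a global minimizer of (RPMIO), where $\mathbf e_1,\dots,\mathbf e_\ell$ are the standard basis vectors; (iv) for every representing measure $\sum_{i=1}^rW_i\delta_{\mathbf x^{(i)}}$ as in (i) and every decomposition $W_i=\sum_{l=1}^{m_i}\mathbf v^{(i,l)}(\mathbf v^{(i,l)})^{\mathsf T}$ with $\mathbf v^{(i,l)}\in\mathbb R^m$, one has $P(\mathbf s^\star_{\mathbf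 e},\mathbf x^{(i)})\,\mathbf v^{(i,l)}=0$ for all $i$ and $l$. (If $k_{\mathbf y}=0$, the entries $s^\star_{\mathbf e_i}$ are not constrained by the dual relaxation and may be taken to be arbitrary real numbers.) -/

import Mathlib

open MvPolynomial MeasureTheory
open scoped Matrix Kronecker

noncomputable section

namespace RobustPMI

/-! ### Polynomial matrices -/

section PolynomialMatrices

variable {σ ι κ R : Type*} [CommSemiring R]

/-- The coefficient matrix `F_α` of the monomial with exponent `α` in a polynomial matrix. -/
def coeffMat (F : Matrix ι κ (MvPolynomial σ R)) (α : σ →₀ ℕ) : Matrix ι κ R :=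
  F.map (coeff α)

open Classical in
/-- The set of exponents that occur in some entry of a polynomial matrix. -/
def matSupport [Fintype ι] [Fintype κ] (F : Matrix ι κ (MvPolynomial σ R)) : Finset (σ →₀ ℕ) :=
  Finset.univ.biUnion fun i => Finset.univ.biUnion fun j => (F i j).support

/-- The degree of a polynomial matrix: the largest total degree of an entry. -/
def matDeg [Fintype ι] [Fintype κ] (F : Matrix ι κ (MvPolynomial σ R)) : ℕ :=
  Finset.univ.sup fun i => Finset.univ.sup fun j => (F i j).totalDegree

/-- The real matrix `F(x)`. -/
def evalMat (F : Matrix ι κ (MvPolynomial σ R)) (x : σ → R) : Matrix ι κ R :=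
  F.map (eval x)

end PolynomialMatrices

/-- `⌈d / 2⌉` for a natural number `d`. -/
def ceilHalf (d : ℕ) : ℕ := (d + 1) / 2

/-- SOS matrices: `F = Tᵀ T` for a polynomial matrix `T` with finitely many rows. -/
def IsSOSMatrix {σ ι : Type*} (F : Matrix ι ι (MvPolynomial σ ℝ)) : Prop :=
  ∃ (r : ℕ) (T : Matrix (Fin r) ι (MvPolynomial σ ℝ)), F = Tᵀ * T

/-- The Hessian of a polynomial. -/
def hessian {σ : Type*} (h : MvPolynomial σ ℝ) : Matrix σ σ (MvPolynomial σ ℝ) :=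
  Matrix.of fun i j => pderiv i (pderiv j h)

/-- SOS-convexity: the Hessian is an SOS matrix. -/
def IsSOSConvex {σ : Type*} (h : MvPolynomial σ ℝ) : Prop :=
  IsSOSMatrix (hessian h)

/-- PSD-SOS-convexity: the Hessian of `vᵀ Q(y) v` is an SOS matrix for every real vector `v`. -/
def IsPSDSOSConvex {σ : Type*} {m : ℕ} (Q : Matrix (Fin m) (Fin m) (MvPolynomial σ ℝ)) : Prop :=
  ∀ v : Fin m → ℝ, IsSOSConvex (∑ i, ∑ j, C (v i * v j) * Q i j)

/-! ### Truncated matrix quadratic modules -/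

/-- The blockwise trace `tr_m(C)`, with block size `q`. -/
def blockTrace {R : Type*} [CommRing R] {m q : ℕ}
    (A : Matrix (Fin m × Fin q) (Fin m × Fin q) R) : Matrix (Fin m) (Fin m) R :=
  Matrix.of fun i j => ∑ a : Fin q, A (i, a) (j, a)

/-- The bilinear map `(A, B)_m = tr_m(Aᵀ (I_m ⊗ B))`. -/
def blockPairing {R : Type*} [CommRing R] {m q : ℕ}
    (A : Matrix (Fin m × Fin q) (Fin m × Fin q) R) (B : Matrix (Fin q) (Fin q) R) :
    Matrix (Fin m) (Fin m) R :=
  blockTrace (Aᵀ * ((1 : Matrix (Fin m) (Fin m) R) ⊗ₖ B))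

/-- The truncated matrix quadratic module `Q^m_k(G)`. -/
def quadModule {n q : ℕ} (m k : ℕ) (G : Matrix (Fin q) (Fin q) (MvPolynomial (Fin n) ℝ)) :
    Set (Matrix (Fin m) (Fin m) (MvPolynomial (Fin n) ℝ)) :=
  {F | ∃ (Sig0 : Matrix (Fin m) (Fin m) (MvPolynomial (Fin n) ℝ))
      (Sig1 : Matrix (Fin m × Fin q) (Fin m × Fin q) (MvPolynomial (Fin n) ℝ)),
      IsSOSMatrix Sig0 ∧ IsSOSMatrix Sig1 ∧
      matDeg Sig0 ≤ 2 * k ∧ matDeg (blockPairing Sig1 G) ≤ 2 * k ∧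
      F = Sig0 + blockPairing Sig1 G}

/-- The truncated quadratic module `Q_k(Θ) = Q^1_k(diag(θ_1, …, θ_s))` of scalar polynomials. -/
def scalarQuadModule {l s : ℕ} (k : ℕ) (θ : Fin s → MvPolynomial (Fin l) ℝ) :
    Set (MvPolynomial (Fin l) ℝ) :=
  {p | (Matrix.of fun _ _ => p) ∈ quadModule 1 k (Matrix.diagonal θ)}

/-! ### Matrix-valued sequences, Riesz functionals, moment and localizing matrices

A truncated sequence `(S_α)_{|α| ≤ 2k}` is represented by a function on all exponents; nothing below
that concerns the truncated sequence looks at the entries with `|α| > 2k`. -/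

/-- The exponents `α ∈ ℕ^n` with `|α| ≤ d`. -/
def exps (n d : ℕ) : Finset (Fin n →₀ ℕ) :=
  (Finset.range (d + 1)).biUnion fun i => Finset.univ.finsuppAntidiag i

theorem mem_exps {n d : ℕ} {α : Fin n →₀ ℕ} : α ∈ exps n d ↔ α.degree ≤ d := by
  simp [exps, Finsupp.degree_eq_sum]

/-- Multi-indexed sequences of real `m × m` matrices. -/
abbrev MatSeq (n m : ℕ) : Type := (Fin n →₀ ℕ) → Matrix (Fin m) (Fin m) ℝ

/-- The Riesz functional `L_S(F) = ∑_α tr(F_α S_α)`. -/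
def riesz {n m : ℕ} (S : MatSeq n m) (F : Matrix (Fin m) (Fin m) (MvPolynomial (Fin n) ℝ)) : ℝ :=
  ∑ α ∈ matSupport F, (coeffMat F α * S α).trace

/-- The scalar Riesz functional `H_s(h) = ∑_α h_α s_α`. -/
def scalarRiesz {l : ℕ} (s : (Fin l →₀ ℕ) → ℝ) (h : MvPolynomial (Fin l) ℝ) : ℝ :=
  ∑ α ∈ h.support, coeff α h * s α

/-- The moment matrix `M_d(S)`: the block at `(α, β)` is `S_{α+β}`. -/
def momentMatrix {n m : ℕ} (d : ℕ) (S : MatSeq n m) :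
    Matrix (exps n d × Fin m) (exps n d × Fin m) ℝ :=
  Matrix.of fun a b => S (a.1.1 + b.1.1) a.2 b.2

/-- The localizing matrix `M_d(G S)`: the block at `(α, β)` is `∑_γ S_{α+β+γ} ⊗ G_γ`. -/
def localizingMatrix {n m q : ℕ} (d : ℕ) (G : Matrix (Fin q) (Fin q) (MvPolynomial (Fin n) ℝ))
    (S : MatSeq n m) :
    Matrix (exps n d × (Fin m × Fin q)) (exps n d × (Fin m × Fin q)) ℝ :=
  Matrix.of fun a b =>
    (∑ γ ∈ matSupport G, S (a.1.1 + b.1.1 + γ) ⊗ₖ coeffMat G γ) a.2 b.2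

/-- The number `d_G = ⌈deg(G) / 2⌉`. -/
def halfDeg {n q : ℕ} (G : Matrix (Fin q) (Fin q) (MvPolynomial (Fin n) ℝ)) : ℕ :=
  ceilHalf (matDeg G)

/-- The cone `M^m_k(G)` of truncated sequences of symmetric matrices, for `k ≥ d_G`. -/
def momentCone {n q : ℕ} (m k : ℕ) (G : Matrix (Fin q) (Fin q) (MvPolynomial (Fin n) ℝ)) :
    Set (MatSeq n m) :=
  {S | (∀ α ∈ exps n (2 * k), (S α).IsSymm) ∧ (momentMatrix k S).PosSemidef ∧
    (localizingMatrix (k - halfDeg G) G S).PosSemidef}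

/-- The cone `M_k(Θ) = M^1_k(diag(θ_1, …, θ_s))` of truncated scalar sequences. -/
def scalarMomentCone {l s : ℕ} (k : ℕ) (θ : Fin s → MvPolynomial (Fin l) ℝ) :
    Set ((Fin l →₀ ℕ) → ℝ) :=
  {u | (fun α => Matrix.of fun _ _ => u α) ∈ momentCone 1 k (Matrix.diagonal θ)}

/-! ### Matrix-valued measures -/

/-- `m × m` matrix-valued measures `Φ = [φ_ij]` with finite signed measures `φ_ij` as entries. -/
abbrev MatMeasure (Ω : Type*) [MeasurableSpace Ω] (m : ℕ) : Type _ :=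
  Matrix (Fin m) (Fin m) (SignedMeasure Ω)

section Measures

variable {Ω : Type*} [MeasurableSpace Ω] {m : ℕ}

/-- `Φ(A)` is symmetric positive semidefinite for every measurable set `A`. -/
def MatMeasure.IsPSD (Φ : MatMeasure Ω m) : Prop :=
  ∀ A : Set Ω, MeasurableSet A → (Matrix.of fun i j => Φ i j A).PosSemidef

/-- `h` is integrable with respect to every entry of `Φ`. -/
def MatMeasure.IntegrableFun (Φ : MatMeasure Ω m) (h : Ω → ℝ) : Prop :=
  ∀ i j, (Φ i j).Integrable h

/-- The matrix-valued integral `∫ h dΦ = [∫ h dφ_ij]`. -/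
def MatMeasure.integral (Φ : MatMeasure Ω m) (h : Ω → ℝ) : Matrix (Fin m) (Fin m) ℝ :=
  Matrix.of fun i j => VectorMeasure.integral (Φ i j) h (ContinuousLinearMap.lsmul ℝ ℝ)

/-- The finitely atomic matrix-valued measure `∑_i W_i δ_{x_i}`. -/
def MatMeasure.atomic {r : ℕ} (W : Fin r → Matrix (Fin m) (Fin m) ℝ) (x : Fin r → Ω) :
    MatMeasure Ω m :=
  Matrix.of fun a b => ∑ i, VectorMeasure.dirac (x i) (W i a b)

end Measures

/-- `Φ` is a PSD matrix-valued measure on `X` that represents the truncated sequence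
`(S_α)_{|α| ≤ d}`, that is, `S_α = ∫_X x^α dΦ(x)` for all `|α| ≤ d`. -/
def Represents {n m : ℕ} {X : Set (Fin n → ℝ)} (Φ : MatMeasure X m) (d : ℕ)
    (S : MatSeq n m) : Prop :=
  Φ.IsPSD ∧ ∀ α ∈ exps n d,
    Φ.IntegrableFun (fun x : X => ∏ i, x.1 i ^ α i) ∧
    S α = Φ.integral (fun x : X => ∏ i, x.1 i ^ α i)

/-- `Φ = ∑_{i<r} W_i δ_{x_i}` with PSD weights `W_i` and distinct points `x_i ∈ X` is a
representing measure of `(S_α)_{|α| ≤ d}`. -/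
def AtomicRepresentation {n m : ℕ} {X : Set (Fin n → ℝ)} (d : ℕ) (S : MatSeq n m)
    {r : ℕ} (W : Fin r → Matrix (Fin m) (Fin m) ℝ) (x : Fin r → X) : Prop :=
  Function.Injective x ∧ (∀ i, (W i).PosSemidef) ∧ Represents (MatMeasure.atomic W x) d S

/-! ### The robust polynomial matrix inequality problem and its relaxations -/

end RobustPMI

/-- The data of the problem: minimize `f(y)` over all `y` with `θ_j(y) ≥ 0` for all `j` and
`P(y, x) ⪰ 0` for all `x` with `G(x) ⪰ 0`. The entries of `P` are polynomials in
`y` whose coefficients are polynomials in `x`. -/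
structure RPMIO (l n m q s : ℕ) where
  f : MvPolynomial (Fin l) ℝ
  θ : Fin s → MvPolynomial (Fin l) ℝ
  G : Matrix (Fin q) (Fin q) (MvPolynomial (Fin n) ℝ)
  P : Matrix (Fin m) (Fin m) (MvPolynomial (Fin l) (MvPolynomial (Fin n) ℝ))
  G_symm : G.IsSymm
  P_symm : P.IsSymm

namespace RPMIO

open RobustPMI

variable {l n m q s : ℕ} (p : RPMIO l n m q s)

/-- The uncertainty set `X = {x | G(x) ⪰ 0}`. -/
def X : Set (Fin n → ℝ) := {x | (evalMat p.G x).PosSemidef}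

/-- The set `Y = {y | θ_1(y) ≥ 0, …, θ_s(y) ≥ 0}`. -/
def Y : Set (Fin l → ℝ) := {y | ∀ j, 0 ≤ eval y (p.θ j)}

/-- `P(·, x)` as a polynomial matrix in `y`. -/
def PAt (x : Fin n → ℝ) : Matrix (Fin m) (Fin m) (MvPolynomial (Fin l) ℝ) :=
  p.P.map (MvPolynomial.map (eval x))

/-- The real matrix `P(y, x)`. -/
def PEval (y : Fin l → ℝ) (x : Fin n → ℝ) : Matrix (Fin m) (Fin m) ℝ :=
  evalMat (p.PAt x) y

/-- The feasible set of the problem. -/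
def feasible : Set (Fin l → ℝ) := {y | y ∈ p.Y ∧ ∀ x ∈ p.X, (p.PEval y x).PosSemidef}

/-- The optimal value `f*` (with `+∞` for an infeasible problem). -/
def optValue : EReal := ⨅ y ∈ p.feasible, ((eval y p.f : ℝ) : EReal)

/-- `y` is an optimal solution (a global minimizer). -/
def IsOptimal (y : Fin l → ℝ) : Prop :=
  y ∈ p.feasible ∧ ∀ z ∈ p.feasible, eval y p.f ≤ eval z p.f

/-- SOS-convexity of the data and compactness of `X`. -/
structure SOSConvexData : Prop where
  f_convex : IsSOSConvex p.f
  θ_convex : ∀ j, IsSOSConvex (-p.θ j)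
  P_convex : ∀ x ∈ p.X, IsPSDSOSConvex (-p.PAt x)
  X_compact : IsCompact p.X

/-- The Slater condition. -/
def Slater : Prop :=
  ∃ y, (∀ j, 0 < eval y (p.θ j)) ∧ ∀ x ∈ p.X, (p.PEval y x).PosDef

/-- `k_y`, the largest of `deg f`, the `deg θ_j` and the `deg_y P_ij`. -/
def kY : ℕ := max p.f.totalDegree (max (Finset.univ.sup fun j => (p.θ j).totalDegree) (matDeg p.P))

/-- `k_x`, the largest of the `deg_x P_ij` and `deg G`. -/
def kX : ℕ := max ((matSupport p.P).sup fun β => matDeg (coeffMat p.P β)) (matDeg p.G)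

/-- `L_S(P(y, x)) = ∑_β L_S(P_β(x)) y^β`, a polynomial in `y`. -/
def rieszP (S : MatSeq n m) : MvPolynomial (Fin l) ℝ :=
  ∑ β ∈ matSupport p.P, monomial β (riesz S (coeffMat p.P β))

/-- `H_u(P(y, x)) = ∑_β P_β(x) u_β`, a polynomial matrix in `x`. -/
def scalarRieszP (u : (Fin l →₀ ℕ) → ℝ) : Matrix (Fin m) (Fin m) (MvPolynomial (Fin n) ℝ) :=
  ∑ β ∈ matSupport p.P, u β • coeffMat p.P β

/-- Feasibility of `(ρ, S)` for the primal relaxation of order `k`. -/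
def PrimalFeasible (k : ℕ) (ρ : ℝ) (S : MatSeq n m) : Prop :=
  p.f - C ρ - p.rieszP S ∈ scalarQuadModule (ceilHalf p.kY) p.θ ∧ S ∈ momentCone m k p.G

/-- The optimal value of the primal relaxation of order `k` (a supremum). -/
def primalValue (k : ℕ) : EReal := ⨆ (ρ : ℝ) (S : MatSeq n m) (_ : p.PrimalFeasible k ρ S), (ρ : EReal)

/-- `(ρ, S)` is an optimal solution of the primal relaxation of order `k`. -/
def PrimalOptimal (k : ℕ) (ρ : ℝ) (S : MatSeq n m) : Prop :=
  p.PrimalFeasible k ρ S ∧ (ρ : EReal) = p.primalValue k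

/-- Feasibility of `u` for the dual relaxation of order `k`. -/
def DualFeasible (k : ℕ) (u : (Fin l →₀ ℕ) → ℝ) : Prop :=
  u ∈ scalarMomentCone (ceilHalf p.kY) p.θ ∧ scalarRiesz u 1 = 1 ∧
    p.scalarRieszP u ∈ quadModule m k p.G

/-- The optimal value of the dual relaxation of order `k` (an infimum). -/
def dualValue (k : ℕ) : EReal :=
  ⨅ (u : (Fin l →₀ ℕ) → ℝ) (_ : p.DualFeasible k u), ((scalarRiesz u p.f : ℝ) : EReal)

/-- `u` is an optimal solution of the dual relaxation of order `k`. -/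
def DualOptimal (k : ℕ) (u : (Fin l →₀ ℕ) → ℝ) : Prop :=
  p.DualFeasible k u ∧ ((scalarRiesz u p.f : ℝ) : EReal) = p.dualValue k

end RPMIO

namespace RobustPMI

/-- The vector `u_e = (u_{e_1}, …, u_{e_l})` of the first-order entries of `u`. -/
def firstOrder {l : ℕ} (u : (Fin l →₀ ℕ) → ℝ) : Fin l → ℝ :=
  fun i => u (Finsupp.single i 1)

end RobustPMI

end

/-! Part (i) is a flat extension theorem for matrix-valued sequences. A positive semidefinite moment
matrix is a Gram matrix, with block entries `⟪ξ α a, ξ β b⟫`. Flatness says that the vectors of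
degree at most `t - d_G` already span the space, so multiplication by each coordinate becomes a
well-defined symmetric operator. These operators commute; their joint eigenvalues are the atoms, and
the projections of the vectors `ξ 0 a` to the joint eigenspaces give the weights as Gram matrices
(`exists_atoms_of_flat`). Testing the localizing matrix with a polynomial vector that isolates one
atom shows that `G` is positive semidefinite there (`exists_atomicRepresentation_of_flat`).

The inequality in (ii) is weak duality. Once `S` has atoms, `L_S(P)(y)` is the sum of the `tr(P(y,
x_i) W_i)`, which is nonnegative for feasible `y`; evaluating the primal certificate at a minimizer
gives `ρ ≤ f*`.

Equality rests on one algebraic fact: the first-order Taylor remainder of an SOS-convex polynomial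
is a sum of squares (`isSOSPoly_taylorRem`). The constraints `vᵀ P(·, x) v ≥ 0` and `θ_j ≥ 0`, with
`v` on a sphere, form a compact family, so the Slater condition yields finitely many KKT multipliers
(`exists_kkt_multipliers`). The Lagrangian minus its value is then the Taylor remainder of an
SOS-convex polynomial, hence a primal certificate attaining `f*`
(`IsOptimal.exists_primalFeasible`).

The same fact gives Jensen's inequality for pseudo-moments (`eval_firstOrder_le_scalarRieszHom`).
For dual feasible `u` it makes `firstOrder u` feasible with objective at most `H_u(f)`, which is
(iii). If the values agree, the nonnegative traces at `firstOrder u` sum to zero, and this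
complementary slackness is (iv). -/

noncomputable section

namespace RobustPMI

/-! ### Values of monomials -/

/-- The value `x^α` of the monomial with exponent `α`. -/
def powAt {n : ℕ} (x : Fin n → ℝ) (α : Fin n →₀ ℕ) : ℝ := ∏ i, x i ^ α i

theorem exists_eq_single_add_of_degree_eq {n N : ℕ} {α : Fin n →₀ ℕ} (hα : α.degree = N + 1) :
    ∃ i β, α = Finsupp.single i 1 + β ∧ β.degree = N := by
  obtain ⟨i, hi⟩ : ∃ i, α i ≠ 0 := by
    by_contra! h
    have : α = 0 := Finsupp.ext h
    simp [this] at hα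
  have hle : Finsupp.single i 1 ≤ α := by
    rw [Finsupp.single_le_iff]; omega
  obtain ⟨β, rfl⟩ := exists_add_of_le hle
  rw [map_add, Finsupp.degree_single] at hα
  exact ⟨i, β, rfl, by omega⟩

section PowAt

variable {n : ℕ} (x : Fin n → ℝ)

@[simp] theorem powAt_zero : powAt x 0 = 1 := by simp [powAt]

theorem powAt_add (α β : Fin n →₀ ℕ) : powAt x (α + β) = powAt x α * powAt x β := by
  simp [powAt, pow_add, Finset.prod_mul_distrib]

@[simp] theorem powAt_single (i : Fin n) : powAt x (Finsupp.single i 1) = x i := by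
  rw [powAt, Finset.prod_eq_single i]
  · simp
  · intro j _ hj
    simp [hj.symm]
  · simp

theorem eval_monomial_eq_powAt (α : Fin n →₀ ℕ) (c : ℝ) :
    eval x (monomial α c) = c * powAt x α := by
  rw [eval_monomial, powAt, Finsupp.prod_fintype _ _ (by simp)]

theorem eval_eq_sum_powAt {h : MvPolynomial (Fin n) ℝ} {s : Finset (Fin n →₀ ℕ)}
    (hs : h.support ⊆ s) : eval x h = ∑ α ∈ s, coeff α h * powAt x α := by
  rw [eval_eq']
  refine Finset.sum_subset hs fun α _ hα => ?_
  rw [notMem_support_iff.mp hα, zero_mul]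

end PowAt

/-! ### Finitely atomic matrix measures -/

section Atomic

variable {Ω : Type*} [MeasurableSpace Ω] {m r : ℕ}

theorem integrable_dirac_vectorMeasure [MeasurableSingletonClass Ω] (h : Ω → ℝ) (y : Ω) (c : ℝ) :
    (VectorMeasure.dirac y c).Integrable h := by
  rw [VectorMeasure.Integrable, VectorMeasure.variation_dirac]
  exact (integrable_dirac (by simp)).smul_measure (by simp)

theorem integral_dirac_vectorMeasure [MeasurableSingletonClass Ω] (h : Ω → ℝ) (y : Ω) (c : ℝ) :
    VectorMeasure.integral (VectorMeasure.dirac y c) h (ContinuousLinearMap.lsmul ℝ ℝ) =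
      h y * c := by
  rw [VectorMeasure.integral_dirac]
  rfl

theorem atomic_apply (W : Fin r → Matrix (Fin m) (Fin m) ℝ) (x : Fin r → Ω) (a b : Fin m) :
    MatMeasure.atomic W x a b = ∑ i, VectorMeasure.dirac (x i) (W i a b) := rfl

theorem integrableFun_atomic [MeasurableSingletonClass Ω] (W : Fin r → Matrix (Fin m) (Fin m) ℝ)
    (x : Fin r → Ω) (h : Ω → ℝ) : (MatMeasure.atomic W x).IntegrableFun h := by
  intro a b
  rw [atomic_apply]
  exact VectorMeasure.Integrable.finsetSum_vectorMeasure
    fun i _ => integrable_dirac_vectorMeasure h (x i) (W i a b)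

theorem integral_atomic [MeasurableSingletonClass Ω] (W : Fin r → Matrix (Fin m) (Fin m) ℝ)
    (x : Fin r → Ω) (h : Ω → ℝ) : (MatMeasure.atomic W x).integral h = ∑ i, h (x i) • W i := by
  ext a b
  rw [MatMeasure.integral, Matrix.of_apply, atomic_apply,
    VectorMeasure.integral_finsetSum_vectorMeasure
      fun i _ => integrable_dirac_vectorMeasure h (x i) (W i a b), Matrix.sum_apply]
  exact Finset.sum_congr rfl fun i _ => integral_dirac_vectorMeasure h (x i) (W i a b)

theorem isPSD_atomic {W : Fin r → Matrix (Fin m) (Fin m) ℝ} (hW : ∀ i, (W i).PosSemidef)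
    (x : Fin r → Ω) : (MatMeasure.atomic W x).IsPSD := by
  classical
  intro A hA
  have : (Matrix.of fun i j => MatMeasure.atomic W x i j A) =
      ∑ i, if x i ∈ A then W i else 0 := by
    ext a b
    simp only [MatMeasure.atomic, Matrix.of_apply, Matrix.sum_apply]
    rw [FunLike.coe_sum, Finset.sum_apply]
    refine Finset.sum_congr rfl fun i _ => ?_
    by_cases hx : x i ∈ A <;> simp [hx, hA]
  rw [this]
  refine Matrix.posSemidef_sum _ fun i _ => ?_
  split_ifs
  exacts [hW i, .zero]

theorem atomicRepresentation_iff {n : ℕ} {X : Set (Fin n → ℝ)} {d : ℕ} {S : MatSeq n m}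
    {W : Fin r → Matrix (Fin m) (Fin m) ℝ} {x : Fin r → X} :
    AtomicRepresentation d S W x ↔ Function.Injective x ∧ (∀ i, (W i).PosSemidef) ∧
      ∀ α ∈ exps n d, S α = ∑ i, powAt (x i).1 α • W i := by
  constructor
  · rintro ⟨h1, h2, -, h3⟩
    refine ⟨h1, h2, fun α hα => ?_⟩
    rw [(h3 α hα).2, integral_atomic]
    rfl
  · rintro ⟨h1, h2, h3⟩
    refine ⟨h1, h2, isPSD_atomic h2 x, fun α hα => ⟨integrableFun_atomic _ _ _, ?_⟩⟩
    rw [h3 α hα, integral_atomic]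
    rfl

end Atomic

end RobustPMI

namespace RobustPMI

/-! ### Gram representations and symmetric operators -/

section Operators

open scoped InnerProductSpace

/-- Factor `M = Bᴴ * B`, take the columns of `B` as vectors and their span as the space. Since `BᴴB`
and `B` have equal rank, a principal submatrix of full rank means that the selected columns span as
much as all of them. This is the form in which flatness is used. -/
theorem exists_gram_of_posSemidef {ι : Type} [Fintype ι] {M : Matrix ι ι ℝ} (hM : M.PosSemidef) :
    ∃ (E : Type) (_ : NormedAddCommGroup E) (_ : InnerProductSpace ℝ E)
      (_ : FiniteDimensional ℝ E) (ξ : ι → E), (∀ i j, ⟪ξ i, ξ j⟫_ℝ = M i j) ∧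
      ∀ (κ : Type) [Fintype κ] (e : κ → ι), (M.submatrix e e).rank = M.rank →
        Submodule.span ℝ (Set.range fun j => ξ (e j)) = ⊤ := by
  classical
  obtain ⟨B, hB⟩ : ∃ B : Matrix ι ι ℝ, M = Bᴴ * B := by
    open scoped MatrixOrder in
    exact CStarAlgebra.nonneg_iff_eq_star_mul_self.mp hM.nonneg
  let L := (WithLp.linearEquiv 2 ℝ (ι → ℝ)).symm
  let ξ₀ : ι → EuclideanSpace ℝ ι := fun j => L (B.col j)
  let E := Submodule.span ℝ (Set.range ξ₀)
  have hmem : ∀ j, ξ₀ j ∈ E := fun j => Submodule.subset_span ⟨j, rfl⟩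
  refine ⟨E, inferInstance, inferInstance, inferInstance, fun j => ⟨ξ₀ j, hmem j⟩, ?_, ?_⟩
  · intro i j
    rw [Submodule.coe_inner, hB]
    simp [ξ₀, L, PiLp.inner_apply, Matrix.mul_apply, mul_comm]
  · intro κ _ e he
    have h1 : (M.submatrix e e) = (B.submatrix id e)ᴴ * B.submatrix id e := by
      rw [hB]; ext i j; simp [Matrix.mul_apply]
    rw [h1, hB, Matrix.rank_conjTranspose_mul_self, Matrix.rank_conjTranspose_mul_self,
      Matrix.rank_eq_finrank_span_cols, Matrix.rank_eq_finrank_span_cols] at he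
    have hle : Submodule.span ℝ (Set.range (B.submatrix id e).col) ≤
        Submodule.span ℝ (Set.range B.col) := by
      refine Submodule.span_mono ?_
      rintro _ ⟨j, rfl⟩
      exact ⟨e j, rfl⟩
    have heq := Submodule.eq_of_le_of_finrank_eq hle he
    have h2 : Submodule.span ℝ (Set.range fun j => ξ₀ (e j)) = E := by
      have := congrArg (Submodule.map L.toLinearMap) heq
      rw [Submodule.map_span, Submodule.map_span, ← Set.range_comp, ← Set.range_comp] at this
      exact this
    apply Submodule.map_injective_of_injective E.injective_subtype
    rw [Submodule.map_span, ← Set.range_comp, Submodule.map_top, Submodule.range_subtype]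
    exact h2

variable {E : Type*} [NormedAddCommGroup E] [InnerProductSpace ℝ E]

/-- The point is that `u j ↦ v j` is well defined: if a combination of the `u j` vanishes, the same
combination of the `v j` is orthogonal to every `u k`, hence zero. -/
theorem exists_isSymmetric_of_inner_eq {J : Type*} {u v : J → E}
    (hu : Submodule.span ℝ (Set.range u) = ⊤) (h : ∀ j k, ⟪v j, u k⟫_ℝ = ⟪u j, v k⟫_ℝ) :
    ∃ A : E →ₗ[ℝ] E, A.IsSymmetric ∧ ∀ j, A (u j) = v j := by
  let U := Finsupp.linearCombination ℝ u
  let V := Finsupp.linearCombination ℝ v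
  have hU : LinearMap.range U = ⊤ := by rw [Finsupp.range_linearCombination, hu]
  have hUV : ∀ c d, ⟪V c, U d⟫_ℝ = ⟪U c, V d⟫_ℝ := by
    intro c d
    simp only [U, V, Finsupp.linearCombination_apply, Finsupp.sum, sum_inner, inner_sum,
      inner_smul_left, inner_smul_right, h]
  have hker : LinearMap.ker U ≤ LinearMap.ker V := by
    intro c hc
    rw [LinearMap.mem_ker] at hc ⊢
    refine ext_inner_right ℝ fun w => ?_
    obtain ⟨d, rfl⟩ := LinearMap.range_eq_top.mp hU w
    rw [hUV, hc, inner_zero_left, inner_zero_left]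
  let A : E →ₗ[ℝ] E := ((LinearMap.ker U).liftQ V hker) ∘ₗ
    (U.quotKerEquivOfSurjective (LinearMap.range_eq_top.mp hU)).symm.toLinearMap
  have hA : ∀ c, A (U c) = V c := by
    intro c
    have : (U.quotKerEquivOfSurjective (LinearMap.range_eq_top.mp hU)).symm (U c) =
        Submodule.Quotient.mk c := by
      rw [LinearEquiv.symm_apply_eq]
      rfl
    simp only [A, LinearMap.comp_apply, LinearEquiv.coe_coe, this]
    exact Submodule.liftQ_apply _ _ _
  refine ⟨A, fun x y => ?_, fun j => ?_⟩
  · obtain ⟨c, rfl⟩ := LinearMap.range_eq_top.mp hU x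
    obtain ⟨d, rfl⟩ := LinearMap.range_eq_top.mp hU y
    rw [hA, hA, hUV]
  · have := hA (Finsupp.single j 1)
    simpa [U, V] using this

/-- The `Q i` are the orthogonal projections onto the nonzero joint eigenspaces, finitely many
because these are independent in finite dimension. -/
theorem exists_joint_spectral_decomposition [FiniteDimensional ℝ E] {n : ℕ}
    {A : Fin n → E →ₗ[ℝ] E} (hA : ∀ i, (A i).IsSymmetric) (hc : ∀ i j, Commute (A i) (A j)) :
    ∃ (r : ℕ) (x : Fin r → Fin n → ℝ) (Q : Fin r → E →ₗ[ℝ] E), Function.Injective x ∧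
      (∀ v, ∑ i, Q i v = v) ∧ (∀ i j, i ≠ j → ∀ u v, ⟪Q i u, Q j v⟫_ℝ = 0) ∧
      (∀ i j v, A j (Q i v) = x i j • Q i v) ∧ ∀ i, ∃ v, v ≠ 0 ∧ Q i v = v := by
  classical
  let F : (Fin n → ℝ) → Submodule ℝ E := fun χ => ⨅ j, Module.End.eigenspace (A j) (χ j)
  have hF : OrthogonalFamily ℝ (fun χ => F χ) fun χ => (F χ).subtypeₗᵢ :=
    LinearMap.IsSymmetric.orthogonalFamily_iInf_eigenspaces hA
  have htop : ⨆ χ, F χ = ⊤ :=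
    LinearMap.IsSymmetric.iSup_iInf_eq_top_of_commute hA fun i j _ => hc i j
  have hfin : {χ | F χ ≠ ⊥}.Finite := WellFoundedGT.finite_ne_bot_of_iSupIndep hF.independent
  have : Finite {χ | F χ ≠ ⊥} := hfin
  obtain ⟨r, ⟨e⟩⟩ := Finite.exists_equiv_fin {χ | F χ ≠ ⊥}
  obtain ⟨x, hx, hxne, hxall⟩ : ∃ x : Fin r → Fin n → ℝ, Function.Injective x ∧
      (∀ i, F (x i) ≠ ⊥) ∧ ∀ χ, F χ ≠ ⊥ → ∃ i, x i = χ :=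
    ⟨fun i => (e.symm i).1, Subtype.val_injective.comp e.symm.injective,
      fun i => (e.symm i).2, fun χ hχ => ⟨e ⟨χ, hχ⟩, by simp only [Equiv.symm_apply_apply]⟩⟩
  have hV : OrthogonalFamily ℝ (fun i => F (x i)) fun i => (F (x i)).subtypeₗᵢ := hF.comp hx
  have hVtop : ⨆ i, F (x i) = ⊤ := by
    rw [eq_top_iff, ← htop]
    refine iSup_le fun χ => ?_
    by_cases hχ : F χ = ⊥
    · rw [hχ]; exact bot_le
    · obtain ⟨i, rfl⟩ := hxall χ hχ
      exact le_iSup (fun i => F (x i)) i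
  refine ⟨r, x, fun i => (F (x i)).starProjection.toLinearMap, hx, ?_, ?_, ?_, ?_⟩
  · intro v
    exact OrthogonalFamily.sum_projection_of_mem_iSup (V := fun i => F (x i)) hV v
      (hVtop.symm ▸ Submodule.mem_top)
  · intro i j hij u v
    exact hV.isOrtho hij.symm (Submodule.starProjection_apply_mem _ v) _
      (Submodule.starProjection_apply_mem _ u)
  · intro i j v
    have := Submodule.starProjection_apply_mem (F (x i)) v
    exact Module.End.mem_eigenspace_iff.mp ((Submodule.mem_iInf _).mp this j)
  · intro i
    obtain ⟨v, hv, hv0⟩ := (Submodule.ne_bot_iff _).mp (hxne i)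
    exact ⟨v, hv0, Submodule.starProjection_eq_self_iff.mpr hv⟩

end Operators

/-! ### Flat extensions of matrix-valued sequences -/

section Flat

open scoped InnerProductSpace

variable {n m : ℕ}

theorem exists_add_eq_of_degree_le {t : ℕ} {α : Fin n →₀ ℕ} (hα : α.degree ≤ 2 * t) :
    ∃ β γ : Fin n →₀ ℕ, β.degree ≤ t ∧ γ.degree ≤ t ∧ α = β + γ := by
  -- Splitting against two independent bounds `a` and `b` lets the induction lower one of them.
  suffices h : ∀ N (α : Fin n →₀ ℕ), α.degree = N → ∀ a b, N ≤ a + b →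
      ∃ β γ : Fin n →₀ ℕ, β.degree ≤ a ∧ γ.degree ≤ b ∧ α = β + γ from
    h _ α rfl t t (by omega)
  intro N
  induction N with
  | zero =>
    intro α hα a b _
    exact ⟨0, α, by simp, by omega, by simp⟩
  | succ N ih =>
    intro α hα a b hab
    obtain ⟨i, α', rfl, hdeg⟩ := exists_eq_single_add_of_degree_eq hα
    rcases Nat.eq_zero_or_pos a with rfl | ha
    · exact ⟨0, Finsupp.single i 1 + α', by simp, by omega, by simp⟩
    · obtain ⟨β, γ, h1, h2, rfl⟩ := ih α' hdeg (a - 1) b (by omega)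
      refine ⟨Finsupp.single i 1 + β, γ, ?_, h2, by rw [add_assoc]⟩
      rw [map_add, Finsupp.degree_single]; omega

/-- A flat positive semidefinite moment matrix is represented by finitely many atoms, and each atom
is separated from the others by a polynomial vector of the degree at which the rank stabilizes. -/
theorem exists_atoms_of_flat {S : MatSeq n m} {t d : ℕ} (hd : 0 < d) (hdt : d ≤ t)
    (hM : (momentMatrix t S).PosSemidef)
    (hr : (momentMatrix t S).rank = (momentMatrix (t - d) S).rank) :
    ∃ (r : ℕ) (W : Fin r → Matrix (Fin m) (Fin m) ℝ) (x : Fin r → Fin n → ℝ),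
      Function.Injective x ∧ (∀ i, (W i).PosSemidef) ∧
      (∀ α ∈ exps n (2 * t), S α = ∑ i, powAt (x i) α • W i) ∧
      ∀ i, ∃ c : exps n (t - d) × Fin m → ℝ, ∀ j,
        let N := ∑ p, ∑ q, c p * c q * (powAt (x j) p.1.1 * powAt (x j) q.1.1 * W j p.2 q.2)
        (j ≠ i → N = 0) ∧ (j = i → 0 < N) := by
  classical
  obtain ⟨E, _, _, _, ξ', hξ', hspan'⟩ := exists_gram_of_posSemidef hM
  -- The value `0` beyond degree `t` is only a filler; every use below carries a degree bound.
  let ξ : (Fin n →₀ ℕ) → Fin m → E := fun α a =>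
    if h : α ∈ exps n t then ξ' (⟨α, h⟩, a) else 0
  have hξ : ∀ α β a b, α.degree ≤ t → β.degree ≤ t → ⟪ξ α a, ξ β b⟫_ℝ = S (α + β) a b := by
    intro α β a b hα hβ
    rw [← mem_exps] at hα hβ
    simp only [ξ, hα, hβ, dif_pos, hξ']
    rfl
  have hspan : Submodule.span ℝ
      (Set.range fun p : exps n (t - d) × Fin m => ξ p.1.1 p.2) = ⊤ := by
    have hsub : ∀ α : exps n (t - d), α.1 ∈ exps n t := fun α =>
      mem_exps.mpr ((mem_exps.mp α.2).trans (Nat.sub_le _ _))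
    have := hspan' (exps n (t - d) × Fin m) (fun p => (⟨p.1.1, hsub p.1⟩, p.2)) hr.symm
    rw [← this]
    congr 2
    ext p
    simp [ξ, hsub p.1]
  have hdeg : ∀ (α : exps n (t - d)) (i : Fin n),
      (α.1 + Finsupp.single i 1).degree ≤ t := by
    intro α i
    have := mem_exps.mp α.2
    rw [map_add, Finsupp.degree_single]; omega
  have hdeg' : ∀ α : exps n (t - d), α.1.degree ≤ t := fun α =>
    (mem_exps.mp α.2).trans (Nat.sub_le _ _)
  -- Multiplication by the `i`-th coordinate, prescribed on the spanning family. Since `0 < d`, the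
  -- shifted exponents stay within degree `t`; symmetry holds because entries of the moment matrix
  -- depend only on the sum of the two exponents.
  have hop : ∀ i : Fin n, ∃ A : E →ₗ[ℝ] E, A.IsSymmetric ∧ ∀ p : exps n (t - d) × Fin m,
      A (ξ p.1.1 p.2) = ξ (p.1.1 + Finsupp.single i 1) p.2 := by
    intro i
    refine exists_isSymmetric_of_inner_eq hspan fun p q => ?_
    rw [hξ _ _ _ _ (hdeg _ _) (hdeg' _), hξ _ _ _ _ (hdeg' _) (hdeg _ _)]
    congr 1
    abel
  choose A hA hAξ' using hop
  have hext : ∀ u : E, (∀ p : exps n (t - d) × Fin m, ⟪u, ξ p.1.1 p.2⟫_ℝ = 0) → u = 0 := by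
    intro u hu
    have : Submodule.span ℝ (Set.range fun p : exps n (t - d) × Fin m => ξ p.1.1 p.2) ≤
        LinearMap.ker (innerₗ E u) := by
      rw [Submodule.span_le]
      rintro _ ⟨p, rfl⟩
      exact hu p
    rw [hspan] at this
    exact inner_self_eq_zero.mp (this (show u ∈ ⊤ from trivial))
  -- The shift rule extends from degree `t - d` to all degrees below `t`: both sides have the same
  -- inner products with the spanning family.
  have hAξ : ∀ i (α : Fin n →₀ ℕ) a, α.degree < t →
      A i (ξ α a) = ξ (α + Finsupp.single i 1) a := by
    intro i α a hα
    rw [← sub_eq_zero]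
    refine hext _ fun p => ?_
    have h1 : (α + Finsupp.single i 1).degree ≤ t := by
      rw [map_add, Finsupp.degree_single]; omega
    rw [inner_sub_left, hA i, hAξ', hξ _ _ _ _ hα.le (hdeg _ _), hξ _ _ _ _ h1 (hdeg' _),
      sub_eq_zero]
    congr 1
    abel
  -- By symmetry, both orders pair with the spanning family to the entry of `S` at the sum of the
  -- two exponents and the two unit vectors.
  have hcomm : ∀ i j, Commute (A i) (A j) := by
    intro i j
    refine LinearMap.ext_on_range hspan fun p => ?_
    rw [← sub_eq_zero]
    refine hext _ fun q => ?_
    rw [Module.End.mul_apply, Module.End.mul_apply, inner_sub_left, hA i (A j _), hA j (A i _), hAξ' j p,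
      hAξ' i q, hAξ' i p, hAξ' j q, hξ _ _ _ _ (hdeg _ _) (hdeg _ _), hξ _ _ _ _ (hdeg _ _) (hdeg _ _), sub_eq_zero]
    congr 1
    abel
  obtain ⟨r, x, Q, hx, hsum, horth, heig, hne⟩ := exists_joint_spectral_decomposition hA hcomm
  have horthQ : ∀ j k, j ≠ k → ∀ v, Q j (Q k v) = 0 := by
    intro j k hjk v
    rw [← inner_self_eq_zero (𝕜 := ℝ)]
    have h1 : ⟪Q j (Q k v), ∑ i, Q i (Q k v)⟫_ℝ = ⟪Q j (Q k v), Q j (Q k v)⟫_ℝ := by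
      rw [inner_sum, Finset.sum_eq_single j (fun i _ hi => horth j i hi.symm _ _) (by simp)]
    rw [← h1, hsum]
    exact horth j k hjk _ _
  have hQQ : ∀ j v, Q j (Q j v) = Q j v := by
    intro j v
    have h1 : ∑ k, Q k (Q j v) = Q j (Q j v) :=
      Finset.sum_eq_single j (fun k _ hk => horthQ k j hk v) (by simp)
    rw [← h1, hsum]
  have hpow : ∀ (N : ℕ) (α : Fin n →₀ ℕ) a, α.degree = N → N ≤ t →
      ξ α a = ∑ i, powAt (x i) α • Q i (ξ 0 a) := by
    intro N
    induction N with
    | zero =>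
      intro α a hα _
      rw [Finsupp.degree_eq_zero_iff] at hα
      simp [hα, hsum]
    | succ N ih =>
      intro α a hα hN
      obtain ⟨i, β, rfl, hβ⟩ := exists_eq_single_add_of_degree_eq hα
      rw [add_comm, ← hAξ i β a (by omega), ih β a hβ (by omega), map_sum]
      refine Finset.sum_congr rfl fun k _ => ?_
      rw [map_smul, heig, powAt_add, powAt_single, smul_smul]
  have hinner : ∀ u v : Fin r → E, ⟪∑ i, Q i (u i), ∑ j, Q j (v j)⟫_ℝ =
      ∑ i, ⟪Q i (u i), Q i (v i)⟫_ℝ := by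
    intro u v
    rw [sum_inner]
    refine Finset.sum_congr rfl fun i _ => ?_
    rw [inner_sum, Finset.sum_eq_single i (fun j _ hj => horth i j hj.symm _ _) (by simp)]
  let W : Fin r → Matrix (Fin m) (Fin m) ℝ := fun i => Matrix.gram ℝ fun a => Q i (ξ 0 a)
  have hW : ∀ i a b, W i a b = ⟪Q i (ξ 0 a), Q i (ξ 0 b)⟫_ℝ := fun i a b => rfl
  refine ⟨r, W, x, hx, fun i => Matrix.posSemidef_gram _ _, ?_, ?_⟩
  · intro α hα
    obtain ⟨β, γ, hβ, hγ, rfl⟩ := exists_add_eq_of_degree_le (mem_exps.mp hα)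
    ext a b
    rw [← hξ β γ a b hβ hγ, hpow _ β a rfl hβ, hpow _ γ b rfl hγ]
    simp_rw [← map_smul]
    rw [hinner, Matrix.sum_apply]
    refine Finset.sum_congr rfl fun i _ => ?_
    rw [map_smul, map_smul, inner_smul_left, inner_smul_right, Matrix.smul_apply, hW, powAt_add,
      smul_eq_mul, mul_assoc]
    rfl
  · intro i
    obtain ⟨v, hv0, hv⟩ := hne i
    have hvmem : v ∈ Submodule.span ℝ
        (Set.range fun p : exps n (t - d) × Fin m => ξ p.1.1 p.2) := by rw [hspan]; trivial
    -- An eigenvector `v` for the atom `x i`, written in the low-degree spanning family, gives the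
    -- separating polynomial vector: the sum at `j` is the squared norm of `Q j v`.
    obtain ⟨c, hc⟩ := (Submodule.mem_span_range_iff_exists_fun ℝ).mp hvmem
    refine ⟨c, fun j => ?_⟩
    have hQξ : ∀ p : exps n (t - d) × Fin m,
        Q j (ξ p.1.1 p.2) = powAt (x j) p.1.1 • Q j (ξ 0 p.2) := by
      intro p
      rw [hpow _ _ p.2 rfl (hdeg' _), map_sum, Finset.sum_eq_single j]
      · rw [map_smul, hQQ]
      · intro k _ hk
        rw [map_smul, horthQ j k hk.symm, smul_zero]
      · simp
    have hN : ∑ p, ∑ q, c p * c q * (powAt (x j) p.1.1 * powAt (x j) q.1.1 * W j p.2 q.2) =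
        ⟪Q j v, Q j v⟫_ℝ := by
      rw [← hc, map_sum, sum_inner]
      refine Finset.sum_congr rfl fun p _ => ?_
      rw [inner_sum]
      refine Finset.sum_congr rfl fun q _ => ?_
      rw [map_smul, map_smul, hQξ, hQξ, inner_smul_left, inner_smul_right, inner_smul_left,
        inner_smul_right, hW]
      simp only [conj_trivial]
      ring
    dsimp only
    rw [hN]
    constructor
    · intro hji
      rw [← hv, horthQ j i hji, inner_zero_left]
    · rintro rfl
      rw [hv]
      exact real_inner_self_pos.mpr hv0

end Flat

end RobustPMI

namespace RobustPMI

/-! ### Quadratic forms and coefficient matrices -/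

theorem sum_mul_mul_nonneg_of_posSemidef {ι : Type*} [Fintype ι] {M : Matrix ι ι ℝ}
    (hM : M.PosSemidef) (v : ι → ℝ) : 0 ≤ ∑ i, ∑ j, v i * v j * M i j := by
  have h := hM.dotProduct_mulVec_nonneg v
  refine h.trans_eq ?_
  simp only [dotProduct, Matrix.mulVec, Finset.mul_sum, star_trivial]
  exact Finset.sum_congr rfl fun i _ => Finset.sum_congr rfl fun j _ => by ring

theorem posSemidef_of_sum_mul_mul_nonneg {ι : Type*} [Fintype ι] {M : Matrix ι ι ℝ}
    (hM : M.IsSymm) (h : ∀ v : ι → ℝ, 0 ≤ ∑ i, ∑ j, v i * v j * M i j) : M.PosSemidef := by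
  refine .of_dotProduct_mulVec_nonneg ?_ fun v => (h v).trans_eq ?_
  · rw [Matrix.IsHermitian, Matrix.conjTranspose_eq_transpose_of_trivial]; exact hM
  · simp only [dotProduct, Matrix.mulVec, Finset.mul_sum, star_trivial]
    exact Finset.sum_congr rfl fun i _ => Finset.sum_congr rfl fun j _ => by ring

section Coefficients

variable {σ ι κ R : Type*} [CommSemiring R] [Fintype ι] [Fintype κ]

theorem mem_matSupport {F : Matrix ι κ (MvPolynomial σ R)} {α : σ →₀ ℕ} :
    α ∈ matSupport F ↔ ∃ i j, coeff α (F i j) ≠ 0 := by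
  classical
  simp [matSupport]

theorem support_subset_matSupport (F : Matrix ι κ (MvPolynomial σ R)) (i : ι) (j : κ) :
    (F i j).support ⊆ matSupport F := fun _ hα =>
  mem_matSupport.mpr ⟨i, j, mem_support_iff.mp hα⟩

theorem totalDegree_le_matDeg (F : Matrix ι κ (MvPolynomial σ R)) (i : ι) (j : κ) :
    (F i j).totalDegree ≤ matDeg F :=
  (Finset.le_sup (f := fun j => (F i j).totalDegree) (Finset.mem_univ j)).trans
    (Finset.le_sup (f := fun i => Finset.univ.sup fun j => (F i j).totalDegree)
      (Finset.mem_univ i))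

theorem matDeg_le_iff {F : Matrix ι κ (MvPolynomial σ R)} {d : ℕ} :
    matDeg F ≤ d ↔ ∀ i j, (F i j).totalDegree ≤ d := by
  simp [matDeg, Finset.sup_le_iff]

theorem degree_le_totalDegree {h : MvPolynomial σ R} {α : σ →₀ ℕ} (hα : α ∈ h.support) :
    α.degree ≤ h.totalDegree := le_totalDegree hα

theorem degree_le_matDeg {F : Matrix ι κ (MvPolynomial σ R)} {α : σ →₀ ℕ}
    (hα : α ∈ matSupport F) : α.degree ≤ matDeg F := by
  obtain ⟨i, j, h⟩ := mem_matSupport.mp hα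
  exact (degree_le_totalDegree (mem_support_iff.mpr h)).trans (totalDegree_le_matDeg F i j)

end Coefficients

theorem evalMat_eq_sum {n : ℕ} {ι κ : Type*} [Fintype ι] [Fintype κ]
    (F : Matrix ι κ (MvPolynomial (Fin n) ℝ)) (x : Fin n → ℝ) :
    evalMat F x = ∑ γ ∈ matSupport F, powAt x γ • coeffMat F γ := by
  ext i j
  rw [evalMat, Matrix.map_apply, eval_eq_sum_powAt x (support_subset_matSupport F i j),
    Matrix.sum_apply]
  exact Finset.sum_congr rfl fun α _ => mul_comm _ _

theorem sum_prod_assoc {A B C : Type*} [Fintype A] [Fintype B] [Fintype C]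
    (f : A × (B × C) → ℝ) : ∑ e, f e = ∑ p : A × B, ∑ c, f (p.1, (p.2, c)) := by
  simp only [Fintype.sum_prod_type]

section FlatExtension

variable {n m q : ℕ} {G : Matrix (Fin q) (Fin q) (MvPolynomial (Fin n) ℝ)} {S : MatSeq n m}

theorem momentMatrix_posSemidef_mono {t k : ℕ} (htk : t ≤ k)
    (h : (momentMatrix k S).PosSemidef) : (momentMatrix t S).PosSemidef :=
  h.submatrix (fun p : exps n t × Fin m =>
    ((⟨p.1.1, mem_exps.mpr ((mem_exps.mp p.1.2).trans htk)⟩ : exps n k), p.2))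

theorem localizingMatrix_posSemidef_mono {t k : ℕ} (htk : t ≤ k)
    (h : (localizingMatrix k G S).PosSemidef) : (localizingMatrix t G S).PosSemidef :=
  h.submatrix (fun p : exps n t × (Fin m × Fin q) =>
    ((⟨p.1.1, mem_exps.mpr ((mem_exps.mp p.1.2).trans htk)⟩ : exps n k), p.2))

/-- It remains to place the atoms in the set where `G` is positive semidefinite. The localizing form
at the separating vector of `x i`, tensored with `w`, collapses to a positive multiple of `wᵀ G(x i)
w`. -/
theorem exists_atomicRepresentation_of_flat (hGsymm : G.IsSymm) (hG : 0 < matDeg G) {t k : ℕ}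
    (hS : S ∈ momentCone m k G) (ht : halfDeg G ≤ t) (htk : t ≤ k)
    (hr : (momentMatrix t S).rank = (momentMatrix (t - halfDeg G) S).rank) :
    ∃ (r : ℕ) (W : Fin r → Matrix (Fin m) (Fin m) ℝ)
      (x : Fin r → {x : Fin n → ℝ | (evalMat G x).PosSemidef}),
      AtomicRepresentation (2 * t) S W x := by
  -- Non-constancy of `G` enters here: flatness must compare two different degrees for the shifts to
  -- stay in range.
  have hd : 0 < halfDeg G := by rw [halfDeg, ceilHalf]; omega
  obtain ⟨-, hM, hL⟩ := hS
  obtain ⟨r, W, x, hx, hW, hSW, hsep⟩ :=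
    exists_atoms_of_flat hd ht (momentMatrix_posSemidef_mono htk hM) hr
  have hL' : (localizingMatrix (t - halfDeg G) G S).PosSemidef :=
    localizingMatrix_posSemidef_mono (Nat.sub_le_sub_right htk _) hL
  have hxX : ∀ i, (evalMat G (x i)).PosSemidef := by
    intro i
    refine posSemidef_of_sum_mul_mul_nonneg ?_ fun w => ?_
    · ext a b
      rw [Matrix.transpose_apply, evalMat, Matrix.map_apply, Matrix.map_apply, hGsymm.apply]
    obtain ⟨c, hc⟩ := hsep i
    have hLval : ∀ (p p' : exps n (t - halfDeg G) × Fin m) (b b' : Fin q),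
        localizingMatrix (t - halfDeg G) G S (p.1, (p.2, b)) (p'.1, (p'.2, b')) =
          ∑ j, powAt (x j) p.1.1 * powAt (x j) p'.1.1 * W j p.2 p'.2 *
            evalMat G (x j) b b' := by
      intro p p' b b'
      simp only [localizingMatrix, Matrix.of_apply, Matrix.sum_apply, Matrix.kroneckerMap_apply]
      simp_rw [evalMat_eq_sum, Matrix.sum_apply, Finset.mul_sum]
      rw [Finset.sum_comm]
      refine Finset.sum_congr rfl fun γ hγ => ?_
      -- The localizing matrix only sees moments of degree at most `2(t - d_G) + deg G ≤ 2t`, where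
      -- the atoms represent `S`.
      have hdeg : p.1.1 + p'.1.1 + γ ∈ exps n (2 * t) := by
        have h1 := mem_exps.mp p.1.2
        have h2 := mem_exps.mp p'.1.2
        have h3 := degree_le_matDeg hγ
        have h4 : matDeg G ≤ 2 * halfDeg G := by rw [halfDeg, ceilHalf]; omega
        rw [mem_exps, map_add, map_add]; omega
      rw [hSW _ hdeg, Matrix.sum_apply, Finset.sum_mul]
      refine Finset.sum_congr rfl fun j _ => ?_
      simp only [Matrix.smul_apply, smul_eq_mul, powAt_add]
      ring
    have h0 := sum_mul_mul_nonneg_of_posSemidef hL'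
      (fun e : exps n (t - halfDeg G) × (Fin m × Fin q) => c (e.1, e.2.1) * w e.2.2)
    let N : Fin r → ℝ := fun j =>
      ∑ p, ∑ q, c p * c q * (powAt (x j) p.1.1 * powAt (x j) q.1.1 * W j p.2 q.2)
    have h1 : ∑ e : exps n (t - halfDeg G) × (Fin m × Fin q),
        ∑ e' : exps n (t - halfDeg G) × (Fin m × Fin q),
        (c (e.1, e.2.1) * w e.2.2) * (c (e'.1, e'.2.1) * w e'.2.2) *
          localizingMatrix (t - halfDeg G) G S e e' =
        ∑ j, N j * ∑ b, ∑ b', w b * w b' * evalMat G (x j) b b' := by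
      simp_rw [sum_prod_assoc]
      simp only [N, Finset.sum_mul_sum]
      conv_rhs => rw [Finset.sum_comm]
      refine Finset.sum_congr rfl fun p _ => ?_
      conv_rhs => rw [Finset.sum_comm]
      refine Finset.sum_congr rfl fun b _ => ?_
      conv_rhs => rw [Finset.sum_comm]
      refine Finset.sum_congr rfl fun p' _ => ?_
      conv_rhs => rw [Finset.sum_comm]
      refine Finset.sum_congr rfl fun b' _ => ?_
      rw [hLval, Finset.mul_sum]
      exact Finset.sum_congr rfl fun j _ => by ring
    rw [h1, Finset.sum_eq_single i (fun j _ hj => by rw [show N j = 0 from (hc j).1 hj, zero_mul]) (by simp)] at h0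
    exact nonneg_of_mul_nonneg_right h0 ((hc i).2 rfl)
  refine ⟨r, W, fun i => ⟨x i, hxX i⟩, atomicRepresentation_iff.mpr ⟨?_, hW, hSW⟩⟩
  intro i j hij
  exact hx (congrArg Subtype.val hij)

end FlatExtension

end RobustPMI

namespace RobustPMI

/-! ### Sums of squares -/

section SumsOfSquares

variable {σ : Type*}

/-- Sums of squares of polynomials. -/
def IsSOSPoly (p : MvPolynomial σ ℝ) : Prop :=
  ∃ (r : ℕ) (g : Fin r → MvPolynomial σ ℝ), p = ∑ i, g i ^ 2

theorem isSOSPoly_sum_sq {κ : Type*} [Fintype κ] (g : κ → MvPolynomial σ ℝ) :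
    IsSOSPoly (∑ i, g i ^ 2) := by
  let e := Fintype.equivFin κ
  exact ⟨_, fun i => g (e.symm i), (e.symm.sum_comp fun i => g i ^ 2).symm⟩

theorem IsSOSPoly.eval_nonneg {p : MvPolynomial σ ℝ} (h : IsSOSPoly p) (y : σ → ℝ) :
    0 ≤ eval y p := by
  obtain ⟨r, g, rfl⟩ := h
  rw [map_sum]
  exact Finset.sum_nonneg fun i _ => by rw [map_pow]; positivity

theorem IsSOSPoly.map {τ : Type*} {p : MvPolynomial σ ℝ} (h : IsSOSPoly p)
    (φ : MvPolynomial σ ℝ →ₐ[ℝ] MvPolynomial τ ℝ) : IsSOSPoly (φ p) := by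
  obtain ⟨r, g, rfl⟩ := h
  exact ⟨r, fun i => φ (g i), by simp⟩

theorem IsSOSPoly.isSOSMatrix {ι : Type*} [Unique ι] {p : MvPolynomial σ ℝ} (h : IsSOSPoly p) :
    IsSOSMatrix (Matrix.of fun _ _ : ι => p) := by
  obtain ⟨r, g, rfl⟩ := h
  refine ⟨r, Matrix.of fun i _ => g i, ?_⟩
  ext1 i j
  simp [Matrix.mul_apply, pow_two]

theorem exists_eq_transpose_mul_self {ι : Type*} [Fintype ι] {M : Matrix ι ι ℝ}
    (hM : M.PosSemidef) : ∃ B : Matrix ι ι ℝ, M = Bᵀ * B := by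
  classical
  open scoped MatrixOrder in
  exact CStarAlgebra.nonneg_iff_eq_star_mul_self.mp hM.nonneg

theorem isSOSMatrix_sum {ι κ : Type*} [Fintype κ] {F : κ → Matrix ι ι (MvPolynomial σ ℝ)}
    (hF : ∀ k, IsSOSMatrix (F k)) : IsSOSMatrix (∑ k, F k) := by
  choose r T hT using hF
  let e := Fintype.equivFin (Σ k, Fin (r k))
  refine ⟨_, Matrix.of fun i j => T (e.symm i).1 (e.symm i).2 j, ?_⟩
  ext1 i j
  rw [Matrix.sum_apply, Matrix.mul_apply]
  simp only [Matrix.transpose_apply, Matrix.of_apply]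
  rw [e.symm.sum_comp (fun s => T s.1 s.2 i * T s.1 s.2 j), Fintype.sum_sigma]
  refine Finset.sum_congr rfl fun k _ => ?_
  rw [hT k, Matrix.mul_apply]
  rfl

theorem IsSOSMatrix.smul {ι : Type*} {F : Matrix ι ι (MvPolynomial σ ℝ)} (hF : IsSOSMatrix F)
    {c : ℝ} (hc : 0 ≤ c) : IsSOSMatrix (c • F) := by
  obtain ⟨r, T, rfl⟩ := hF
  refine ⟨r, √c • T, ?_⟩
  rw [Matrix.transpose_smul, Matrix.smul_mul, Matrix.mul_smul, smul_smul, Real.mul_self_sqrt hc]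

theorem IsSOSMatrix.map {τ ι : Type*} {F : Matrix ι ι (MvPolynomial σ ℝ)} (hF : IsSOSMatrix F)
    (φ : MvPolynomial σ ℝ →ₐ[ℝ] MvPolynomial τ ℝ) : IsSOSMatrix (F.map φ) := by
  obtain ⟨r, T, rfl⟩ := hF
  exact ⟨r, T.map φ, by rw [Matrix.map_mul, Matrix.transpose_map]⟩

theorem IsSOSConvex.sum_smul {κ : Type*} [Fintype κ] {h : κ → MvPolynomial σ ℝ}
    (hh : ∀ k, IsSOSConvex (h k)) {c : κ → ℝ} (hc : ∀ k, 0 ≤ c k) :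
    IsSOSConvex (∑ k, c k • h k) := by
  have : hessian (∑ k, c k • h k) = ∑ k, c k • hessian (h k) := by
    ext1 i j
    simp [hessian, Matrix.sum_apply]
  rw [IsSOSConvex, this]
  exact isSOSMatrix_sum fun k => (hh k).smul (hc k)

end SumsOfSquares

/-! ### The Taylor remainder of an SOS-convex polynomial -/

section Taylor

variable {l : ℕ}

/-- The remainder of the first order Taylor expansion at `a`. -/
def taylorRem (a : Fin l → ℝ) (h : MvPolynomial (Fin l) ℝ) : MvPolynomial (Fin l) ℝ :=
  h - C (eval a h) - ∑ i, C (eval a (pderiv i h)) * (X i - C (a i))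

/-- The substitution `y ↦ y + a`. -/
def shift (a : Fin l → ℝ) : MvPolynomial (Fin l) ℝ →ₐ[ℝ] MvPolynomial (Fin l) ℝ :=
  aeval fun i => X i + C (a i)

theorem pderiv_shift (a : Fin l → ℝ) (i : Fin l) (h : MvPolynomial (Fin l) ℝ) :
    pderiv i (shift a h) = shift a (pderiv i h) := by
  induction h using MvPolynomial.induction_on with
  | C c => simp [shift, algebraMap_eq]
  | add p q hp hq => simp [hp, hq]
  | mul_X p j hp =>
    rw [map_mul, pderiv_mul, pderiv_mul, hp, map_add, map_mul, map_mul]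
    congr 2
    by_cases hij : i = j
    · subst hij
      simp [shift]
    · simp [shift, pderiv_X_of_ne (Ne.symm hij)]

theorem eval_shift (a y : Fin l → ℝ) (h : MvPolynomial (Fin l) ℝ) :
    eval y (shift a h) = eval (y + a) h := by
  induction h using MvPolynomial.induction_on with
  | C c => simp [shift, algebraMap_eq]
  | add p q hp hq => simp [hp, hq]
  | mul_X p j hp =>
    rw [map_mul, map_mul, map_mul, hp]
    simp [shift]

theorem shift_neg_shift (a : Fin l → ℝ) (h : MvPolynomial (Fin l) ℝ) :
    shift (-a) (shift a h) = h := by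
  refine funext fun y => ?_
  rw [eval_shift, eval_shift, neg_add_cancel_right]

theorem IsSOSConvex.shift {h : MvPolynomial (Fin l) ℝ} (hh : IsSOSConvex h) (a : Fin l → ℝ) :
    IsSOSConvex (shift a h) := by
  have : hessian (RobustPMI.shift a h) = (hessian h).map (RobustPMI.shift a) := by
    ext1 i j
    simp [hessian, pderiv_shift]
  rw [IsSOSConvex, this]
  exact IsSOSMatrix.map hh _

/-- Reduces everything to the base point `0`, where the remainder can be read off from homogeneous
components. -/
theorem taylorRem_eq_shift (a : Fin l → ℝ) (h : MvPolynomial (Fin l) ℝ) :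
    taylorRem a h = shift (-a) (taylorRem 0 (shift a h)) := by
  rw [taylorRem, taylorRem, map_sub, map_sub, shift_neg_shift, eval_shift, zero_add, map_sum]
  congr 1
  · congr 1
    simp [shift, algebraMap_eq]
  · refine Finset.sum_congr rfl fun i _ => ?_
    rw [pderiv_shift, eval_shift, zero_add]
    simp [shift, algebraMap_eq, sub_eq_add_neg]

theorem eval_taylorRem (a y : Fin l → ℝ) (h : MvPolynomial (Fin l) ℝ) :
    eval y (taylorRem a h) =
      eval y h - eval a h - ∑ i, eval a (pderiv i h) * (y i - a i) := by
  simp [taylorRem]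

/-- Constants are treated apart because the linear term could have degree one; their gradient
vanishes. This covers the relaxation with `k_y = 0`. -/
theorem totalDegree_taylorRem_le (a : Fin l → ℝ) (h : MvPolynomial (Fin l) ℝ) :
    (taylorRem a h).totalDegree ≤ h.totalDegree := by
  rcases Nat.eq_zero_or_pos h.totalDegree with h0 | h0
  · rw [totalDegree_eq_zero_iff_eq_C.mp h0]
    simp [taylorRem]
  · refine (totalDegree_sub _ _).trans (max_le ((totalDegree_sub _ _).trans (max_le le_rfl ?_)) ?_)
    · simp
    · refine totalDegree_finsetSum_le fun i _ => (totalDegree_mul _ _).trans ?_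
      rw [totalDegree_C, zero_add]
      refine (totalDegree_sub _ _).trans (max_le ?_ ?_)
      · rw [totalDegree_X]; exact h0
      · simp

theorem taylorRem_zero (h : MvPolynomial (Fin l) ℝ) :
    taylorRem 0 h = h - homogeneousComponent 0 h - homogeneousComponent 1 h := by
  have h1 : homogeneousComponent 1 h = ∑ i, C (eval 0 (pderiv i h)) * X i := by
    ext α
    simp only [coeff_homogeneousComponent, coeff_sum, coeff_C_mul, coeff_X]
    have h0 : ∀ i, eval 0 (pderiv i h) = coeff (Finsupp.single i 1) h := by
      intro i
      rw [eval_zero, constantCoeff_eq, coeff_pderiv]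
      simp
    simp_rw [h0]
    by_cases hα : α.degree = 1
    · obtain ⟨i, β, rfl, hβ⟩ := exists_eq_single_add_of_degree_eq hα
      obtain rfl := (Finsupp.degree_eq_zero_iff β).mp hβ
      rw [add_zero] at hα ⊢
      rw [if_pos hα, Finset.sum_eq_single i]
      · simp
      · intro j _ hj
        rw [if_neg, mul_zero]
        rwa [Finsupp.single_left_inj one_ne_zero]
      · simp
    · rw [if_neg hα, Finset.sum_eq_zero]
      intro i _
      rw [if_neg, mul_zero]
      rintro rfl
      simp at hα
  rw [taylorRem, h1, homogeneousComponent_zero]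
  simp [eval_zero, constantCoeff_eq]

/-- The entries are the integrals of `(1 - s) s^(i+j)` over `[0, 1]`, so this is the Gram matrix of
the monomials for a nonnegative weight. -/
theorem posSemidef_inv_mul (M : ℕ) :
    (Matrix.of fun i j : Fin M => (((i + j + 2 : ℕ) : ℝ) * ((i + j + 2 : ℕ) - 1))⁻¹).PosSemidef := by
  refine posSemidef_of_sum_mul_mul_nonneg ?_ fun v => ?_
  · ext i j
    simp [add_comm]
  · have h1 : ∀ k : ℕ, (((k + 2 : ℕ) : ℝ) * ((k + 2 : ℕ) - 1))⁻¹ =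
        ∫ s in (0 : ℝ)..1, (1 - s) * s ^ k := by
      intro k
      have : ∀ s : ℝ, (1 - s) * s ^ k = s ^ k - s ^ (k + 1) := fun s => by ring
      simp_rw [this]
      rw [intervalIntegral.integral_sub (by simp) (by simp), integral_pow, integral_pow]
      have h1 : ((k + 2 : ℕ) : ℝ) - 1 = k + 1 := by push_cast; ring
      have h2 : ((k + 1 : ℕ) : ℝ) + 1 = k + 2 := by push_cast; ring
      have h3 : ((k + 2 : ℕ) : ℝ) = k + 2 := by push_cast; ring
      have : (k : ℝ) + 1 ≠ 0 := by positivity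
      have : (k : ℝ) + 2 ≠ 0 := by positivity
      rw [h1, h2, h3, one_pow, one_pow, zero_pow (by omega), zero_pow (by omega)]
      field_simp
      ring
    have h2 : ∑ i, ∑ j, v i * v j *
        (Matrix.of fun i j : Fin M => (((i + j + 2 : ℕ) : ℝ) * ((i + j + 2 : ℕ) - 1))⁻¹) i j =
        ∫ s in (0 : ℝ)..1, (1 - s) * (∑ i, v i * s ^ (i : ℕ)) ^ 2 := by
      simp_rw [Matrix.of_apply, h1, ← intervalIntegral.integral_const_mul]
      have h3 : ∀ s : ℝ, (1 - s) * (∑ i, v i * s ^ (i : ℕ)) ^ 2 =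
          ∑ i, ∑ j, v i * v j * ((1 - s) * s ^ ((i : ℕ) + j)) := by
        intro s
        rw [pow_two, Finset.sum_mul_sum, Finset.mul_sum]
        refine Finset.sum_congr rfl fun i _ => ?_
        rw [Finset.mul_sum]
        exact Finset.sum_congr rfl fun j _ => by ring
      simp_rw [h3]
      rw [intervalIntegral.integral_finsetSum fun i _ =>
        (by fun_prop : Continuous _).intervalIntegrable _ _]
      refine Finset.sum_congr rfl fun i _ => ?_
      rw [intervalIntegral.integral_finsetSum fun j _ =>
        (by fun_prop : Continuous _).intervalIntegrable _ _]
    rw [h2]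
    refine intervalIntegral.integral_nonneg (by norm_num) fun s hs => ?_
    exact mul_nonneg (by linarith [hs.2]) (sq_nonneg _)

/-- Euler's identity, applied to `φ` and to its partial derivatives. -/
theorem sum_X_mul_X_mul_pderiv_pderiv {d : ℕ} {φ : MvPolynomial (Fin l) ℝ}
    (hφ : φ.IsHomogeneous d) :
    ∑ i, ∑ j, X i * X j * pderiv i (pderiv j φ) = C ((d : ℝ) * (d - 1)) * φ := by
  rw [Finset.sum_comm]
  have h1 : ∀ j, ∑ i, X i * X j * pderiv i (pderiv j φ) =
      C ((d : ℝ) - 1) * (X j * pderiv j φ) := by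
    intro j
    have h2 : ∑ i, X i * X j * pderiv i (pderiv j φ) =
        X j * ∑ i, X i * pderiv i (pderiv j φ) := by
      rw [Finset.mul_sum]
      exact Finset.sum_congr rfl fun i _ => by ring
    rw [h2, (hφ.pderiv (i := j)).sum_X_mul_pderiv]
    rcases Nat.eq_zero_or_pos d with rfl | hd
    · have : pderiv j φ = 0 := by
        rw [totalDegree_eq_zero_iff_eq_C.mp (Nat.le_zero.mp hφ.totalDegree_le), pderiv_C]
      simp [this]
    · rw [nsmul_eq_mul, Nat.cast_sub hd]
      simp
      ring
  simp_rw [h1]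
  rw [← Finset.mul_sum, hφ.sum_X_mul_pderiv, nsmul_eq_mul, map_mul]
  simp
  ring

/-- Scaling of the homogeneous components of degree below `N`. -/
def scaleComponents (N : ℕ) (c : ℕ → ℝ) : MvPolynomial (Fin l) ℝ →ₗ[ℝ] MvPolynomial (Fin l) ℝ :=
  ∑ d ∈ Finset.range N, c d • homogeneousComponent d

theorem scaleComponents_of_isHomogeneous {N d : ℕ} (c : ℕ → ℝ) {φ : MvPolynomial (Fin l) ℝ}
    (hφ : φ.IsHomogeneous d) (hd : d < N) : scaleComponents N c φ = c d • φ := by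
  rw [scaleComponents, LinearMap.sum_apply, Finset.sum_eq_single d]
  · rw [LinearMap.smul_apply, homogeneousComponent_eq_self hφ]
  · intro e _ he
    rw [LinearMap.smul_apply, homogeneousComponent_of_mem hφ, if_neg he, smul_zero]
  · intro h
    exact absurd (Finset.mem_range.mpr hd) h

theorem sum_homogeneousComponent_of_lt {h : MvPolynomial (Fin l) ℝ} {N : ℕ}
    (hN : h.totalDegree < N) : ∑ d ∈ Finset.range N, homogeneousComponent d h = h := by
  conv_rhs => rw [← sum_homogeneousComponent h]
  symm
  refine Finset.sum_subset (Finset.range_subset_range.mpr hN) fun d _ hd => ?_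
  refine homogeneousComponent_eq_zero _ _ ?_
  simp only [Finset.mem_range] at hd
  omega

/-- An algebraic form of the integral remainder `∫ (1 - s) xᵀ H(s x) x ds`, with `H` the Hessian. In
degree `d`, `xᵀ H x` is `d(d-1)` times the component of `h`, so dividing by that factor gives the
remainder. Since `xᵀ H x` is a sum of squares `g k ^ 2`, the division turns each square into a
quadratic form in the homogeneous components of `g k`, with the matrix of `posSemidef_inv_mul`. -/
theorem isSOSPoly_taylorRem_zero {h : MvPolynomial (Fin l) ℝ} (hh : IsSOSConvex h) :
    IsSOSPoly (taylorRem 0 h) := by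
  obtain ⟨r, T, hT⟩ := hh
  let g : Fin r → MvPolynomial (Fin l) ℝ := fun k => ∑ i, T k i * X i
  let M := Finset.univ.sup (fun k => (g k).totalDegree) + 1
  -- Large enough to exceed the degree of `h` and every degree `i + j + 2` with `i, j < M`.
  let N := h.totalDegree + 2 * M + 2
  let c : ℕ → ℝ := fun d => ((d : ℝ) * (d - 1))⁻¹
  have hquad : ∑ i, ∑ j, X i * X j * pderiv i (pderiv j h) = ∑ k, g k ^ 2 := by
    have h1 : ∀ i j, pderiv i (pderiv j h) = ∑ k, T k i * T k j := by
      intro i j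
      have := congrFun (congrFun hT i) j
      rw [Matrix.mul_apply] at this
      exact this
    simp_rw [h1, Finset.mul_sum, g, pow_two, Finset.sum_mul_sum]
    conv_lhs =>
      enter [2, i]
      rw [Finset.sum_comm]
    rw [Finset.sum_comm]
    exact Finset.sum_congr rfl fun k _ => Finset.sum_congr rfl fun i _ =>
      Finset.sum_congr rfl fun j _ => by ring
  have hlhs : scaleComponents N c (∑ i, ∑ j, X i * X j * pderiv i (pderiv j h)) =
      taylorRem 0 h := by
    have h1 : ∑ i, ∑ j, X i * X j * pderiv i (pderiv j h) =
        ∑ d ∈ Finset.range N, C ((d : ℝ) * (d - 1)) * homogeneousComponent d h := by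
      conv_lhs => rw [← sum_homogeneousComponent_of_lt (h := h) (N := N) (by omega)]
      simp_rw [map_sum, Finset.mul_sum]
      conv_lhs =>
        enter [2, i]
        rw [Finset.sum_comm]
      rw [Finset.sum_comm]
      exact Finset.sum_congr rfl fun d _ =>
        sum_X_mul_X_mul_pderiv_pderiv (homogeneousComponent_isHomogeneous d h)
    rw [h1, map_sum]
    have h2 : ∀ d ∈ Finset.range N,
        scaleComponents N c (C ((d : ℝ) * (d - 1)) * homogeneousComponent d h) =
        if d < 2 then 0 else homogeneousComponent d h := by
      intro d hd
      rw [C_mul', map_smul, scaleComponents_of_isHomogeneous c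
        (homogeneousComponent_isHomogeneous d h) (Finset.mem_range.mp hd), smul_smul]
      split_ifs with h3
      · interval_cases d <;> simp
      · have h4 : (d : ℝ) * (d - 1) ≠ 0 := by
          have : (2 : ℝ) ≤ d := by exact_mod_cast not_lt.mp h3
          apply mul_ne_zero <;> linarith
        rw [mul_inv_cancel₀ h4, one_smul]
    rw [Finset.sum_congr rfl h2, taylorRem_zero]
    conv_rhs =>
      enter [1, 1]
      rw [← sum_homogeneousComponent_of_lt (h := h) (N := N) (by omega)]
    rw [show N = h.totalDegree + 2 * M + 1 + 1 from rfl, Finset.sum_range_succ',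
      Finset.sum_range_succ', Finset.sum_range_succ', Finset.sum_range_succ']
    simp
  have hrhs : ∀ k, scaleComponents N c (g k ^ 2) = ∑ i : Fin M, ∑ j : Fin M,
      c (i + j + 2) • (homogeneousComponent (i + 1) (g k) * homogeneousComponent (j + 1) (g k)) := by
    intro k
    have hk : (g k).totalDegree < M + 1 := by
      have := Finset.le_sup (f := fun k => (g k).totalDegree) (Finset.mem_univ k)
      omega
    -- Every term of `g k` carries a variable. Components therefore start in degree one, which
    -- explains the offset `i + j + 2` and avoids the vanishing factor in degrees zero and one.
    have h0 : homogeneousComponent 0 (g k) = 0 := by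
      rw [homogeneousComponent_zero, ← constantCoeff_eq]
      simp [g]
    have h1 : g k = ∑ i : Fin M, homogeneousComponent (i + 1) (g k) := by
      conv_lhs => rw [← sum_homogeneousComponent_of_lt hk]
      rw [Finset.sum_range_succ', h0, add_zero, Finset.sum_range]
    conv_lhs => rw [h1]
    rw [pow_two, Finset.sum_mul_sum, map_sum]
    refine Finset.sum_congr rfl fun i _ => ?_
    rw [map_sum]
    refine Finset.sum_congr rfl fun j _ => ?_
    rw [scaleComponents_of_isHomogeneous c
      ((homogeneousComponent_isHomogeneous _ _).mul (homogeneousComponent_isHomogeneous _ _))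
      (by omega)]
    congr 2
    omega
  obtain ⟨B, hB⟩ := exists_eq_transpose_mul_self (posSemidef_inv_mul M)
  have hc : ∀ i j : Fin M, c (i + j + 2) = ∑ e, B e i * B e j := by
    intro i j
    have := congrFun (congrFun hB i) j
    rw [Matrix.mul_apply] at this
    exact this
  have : taylorRem 0 h = ∑ s : Fin r × Fin M,
      (∑ i : Fin M, B s.2 i • homogeneousComponent (i + 1) (g s.1)) ^ 2 := by
    rw [← hlhs, hquad, map_sum, Fintype.sum_prod_type]
    refine Finset.sum_congr rfl fun k _ => ?_
    simp_rw [hrhs, hc, Finset.sum_smul, pow_two, Finset.sum_mul_sum]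
    conv_lhs =>
      enter [2, i]
      rw [Finset.sum_comm]
    rw [Finset.sum_comm]
    exact Finset.sum_congr rfl fun e _ => Finset.sum_congr rfl fun i _ =>
      Finset.sum_congr rfl fun j _ => by rw [smul_mul_smul_comm]
  rw [this]
  exact isSOSPoly_sum_sq _

theorem isSOSPoly_taylorRem {h : MvPolynomial (Fin l) ℝ} (hh : IsSOSConvex h) (a : Fin l → ℝ) :
    IsSOSPoly (taylorRem a h) := by
  rw [taylorRem_eq_shift]
  exact (isSOSPoly_taylorRem_zero (hh.shift a)).map _

theorem IsSOSConvex.gradient_inequality {h : MvPolynomial (Fin l) ℝ} (hh : IsSOSConvex h)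
    (a y : Fin l → ℝ) : eval a h + ∑ i, eval a (pderiv i h) * (y i - a i) ≤ eval y h := by
  have := (isSOSPoly_taylorRem hh a).eval_nonneg y
  rw [eval_taylorRem] at this
  linarith

end Taylor

end RobustPMI

namespace RobustPMI

/-! ### Optimality conditions for compact families of concave constraints -/

section Optimality

open scoped Topology

/-- In finite dimension the convex hull of a compact set is compact. -/
theorem isCompact_convexHull_of_finiteDimensional {E : Type*} [NormedAddCommGroup E]
    [NormedSpace ℝ E] [FiniteDimensional ℝ E] {s : Set E} (hs : IsCompact s) :
    IsCompact (convexHull ℝ s) := by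
  rcases s.eq_empty_or_nonempty with rfl | ⟨z₀, hz₀⟩
  · simp
  let N := Module.finrank ℝ E + 1
  let F : (Fin N → ℝ) × (Fin N → E) → E := fun p => ∑ i, p.1 i • p.2 i
  have hF : Continuous F := by fun_prop
  have hK : IsCompact (stdSimplex ℝ (Fin N) ×ˢ Set.univ.pi fun _ : Fin N => s) :=
    (isCompact_stdSimplex ℝ (Fin N)).prod (isCompact_univ_pi fun _ => hs)
  -- By Carathéodory's theorem `dim + 1` points suffice; shorter combinations are padded with weight
  -- zero at `z₀`.
  convert hK.image hF
  ext x
  constructor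
  · intro hx
    obtain ⟨ι, _, z, w, hz, haff, hw, hw1, rfl⟩ := eq_pos_convex_span_of_mem_convexHull hx
    have hcard : Fintype.card ι ≤ Fintype.card (Fin N) := by
      rw [Fintype.card_fin]
      exact haff.card_le_finrank_succ.trans
        (Nat.add_le_add_right (Submodule.finrank_le _) 1)
    obtain ⟨e⟩ := Function.Embedding.nonempty_of_card_le hcard
    refine ⟨(Function.extend e w 0, Function.extend e z fun _ => z₀), ⟨⟨?_, ?_⟩, ?_⟩, ?_⟩
    · intro j
      by_cases hj : ∃ i, e i = j
      · obtain ⟨i, rfl⟩ := hj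
        exact (hw i).le.trans_eq (e.injective.extend_apply _ _ _).symm
      · dsimp only
        rw [Function.extend_apply' _ _ _ hj]
        exact le_rfl
    · dsimp only
      rw [← hw1]
      exact (Fintype.sum_of_injective e e.injective w (Function.extend e w (0 : Fin N → ℝ))
        (fun j hj => Function.extend_apply' w (0 : Fin N → ℝ) j hj)
        fun i => (e.injective.extend_apply w (0 : Fin N → ℝ) i).symm).symm
    · intro j _
      by_cases hj : ∃ i, e i = j
      · obtain ⟨i, rfl⟩ := hj
        dsimp only
        rw [e.injective.extend_apply]
        exact hz ⟨i, rfl⟩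
      · dsimp only
        rw [Function.extend_apply' _ _ _ hj]
        exact hz₀
    · dsimp only [F]
      refine (Fintype.sum_of_injective e e.injective _ _ (fun j hj => ?_) fun i => ?_).symm
      · rw [Function.extend_apply' _ _ _ hj, Pi.zero_apply, zero_smul]
      · rw [e.injective.extend_apply, e.injective.extend_apply]
  · rintro ⟨⟨w, z⟩, ⟨⟨hw0, hw1⟩, hz⟩, rfl⟩
    exact mem_convexHull_of_exists_fintype w z hw0 hw1 (fun i => hz i trivial) rfl

variable {l : ℕ} {K : Type*} [TopologicalSpace K] [CompactSpace K]

/-- If no nonnegative combination of the vectors `(∇c_κ, c_κ)` equals `(b, 0)`, some direction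
separates them strictly. -/
theorem exists_multipliers_or_direction {γ : K → Fin l → ℝ} {s : K → ℝ} (hγ : Continuous γ)
    (hs : Continuous s) (b : Fin l → ℝ) {e : Fin l → ℝ}
    (he : ∀ κ, 0 < ∑ i, γ κ i * e i + s κ) :
    (∃ (ι : Type) (_ : Fintype ι) (w : ι → ℝ) (κ : ι → K), (∀ i, 0 ≤ w i) ∧
      (∀ j, ∑ i, w i * γ (κ i) j = b j) ∧ ∑ i, w i * s (κ i) = 0) ∨
    ∃ (d : Fin l → ℝ) (τ : ℝ), ∑ i, b i * d i < 0 ∧ ∀ κ, 0 < ∑ i, γ κ i * d i + τ * s κ := by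
  -- With `b = 0` the ray below degenerates and no direction can make the objective decrease; the
  -- empty family of multipliers works.
  by_cases hb : b = 0
  · exact Or.inl ⟨Empty, inferInstance, fun _ => 0, Empty.elim, fun i => i.elim,
      by simp [hb], by simp⟩
  let Γ : K → (Fin l → ℝ) × ℝ := fun κ => (γ κ, s κ)
  let D := convexHull ℝ (Set.range Γ)
  let β : (Fin l → ℝ) × ℝ := (b, 0)
  let R : Set ((Fin l → ℝ) × ℝ) := (fun t : ℝ => t • β) '' Set.Ici 0
  have hD : IsCompact D :=
    isCompact_convexHull_of_finiteDimensional (isCompact_range (hγ.prodMk hs))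
  have hβ : β ≠ 0 := fun h => hb (congrArg Prod.fst h)
  by_cases hdisj : Disjoint D R
  · right
    have hRc : Convex ℝ R := (convex_Ici 0).is_linear_image ⟨fun x y => add_smul x y β,
      fun c x => by rw [smul_eq_mul, mul_smul]⟩
    have hRcl : IsClosed R := (isClosedEmbedding_smul_left hβ).isClosedMap _ isClosed_Ici
    obtain ⟨g, u, v, hgu, huv, hgv⟩ :=
      geometric_hahn_banach_compact_closed (convex_convexHull ℝ _) hD hRc hRcl hdisj
    have hv : v < 0 := by
      have := hgv 0 ⟨0, Set.mem_Ici.mpr le_rfl, zero_smul _ _⟩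
      rwa [map_zero] at this
    have hgβ : 0 ≤ g β := by
      by_contra! h
      have := hgv ((v / g β) • β) ⟨_, Set.mem_Ici.mpr (div_nonneg_of_nonpos hv.le h.le), rfl⟩
      rw [map_smul, smul_eq_mul, div_mul_cancel₀ _ h.ne] at this
      exact lt_irrefl _ this
    have hg : ∀ (x : Fin l → ℝ) (t : ℝ),
        g (x, t) = ∑ i, x i * g (Pi.single i 1, 0) + t * g (0, 1) := by
      intro x t
      have h1 : ((x, t) : (Fin l → ℝ) × ℝ) =
          ∑ i, x i • (Pi.single i 1, 0) + t • ((0 : Fin l → ℝ), (1 : ℝ)) := by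
        ext j
        · simp [Prod.fst_sum, Finset.sum_apply, Pi.single_apply]
        · simp [Prod.snd_sum]
      conv_lhs => rw [h1]
      simp only [map_add, map_sum, map_smul, smul_eq_mul]
    obtain ⟨B, hB⟩ := isCompact_univ.exists_bound_of_continuousOn
      (f := fun κ => ∑ i, γ κ i * b i) (by fun_prop)
    have hu : 0 < -u := by linarith
    -- Separation gives only `0 ≤ g β`. Tilting the direction by `-ε b` makes the first inequality
    -- strict, and `ε` is so small that the margin `-u` on `D` survives.
    let ε := -u / (|B| + 1)
    have hε : 0 < ε := div_pos hu (by positivity)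
    refine ⟨fun i => -g (Pi.single i 1, 0) - ε * b i, -g (0, 1), ?_, fun κ => ?_⟩
    · have h1 : ∑ i, b i * (-g (Pi.single i 1, 0) - ε * b i) = -g β - ε * ∑ i, b i ^ 2 := by
        rw [hg b 0, Finset.mul_sum, zero_mul, add_zero, ← Finset.sum_neg_distrib,
          ← Finset.sum_sub_distrib]
        exact Finset.sum_congr rfl fun i _ => by ring
      have h2 : 0 < ∑ i, b i ^ 2 := by
        obtain ⟨i, hi⟩ := Function.ne_iff.mp hb
        exact Finset.sum_pos' (fun i _ => sq_nonneg _) ⟨i, Finset.mem_univ _, by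
          have : b i ≠ 0 := hi
          positivity⟩
      rw [h1]
      have := mul_pos hε h2
      linarith
    · have h1 : ∑ i, γ κ i * (-g (Pi.single i 1, 0) - ε * b i) + -g (0, 1) * s κ =
          -g (Γ κ) - ε * ∑ i, γ κ i * b i := by
        rw [hg (γ κ) (s κ), Finset.mul_sum, neg_add, ← Finset.sum_neg_distrib]
        have : ∀ i, γ κ i * (-g (Pi.single i 1, 0) - ε * b i) =
            -(γ κ i * g (Pi.single i 1, 0)) - ε * (γ κ i * b i) := fun i => by ring
        simp_rw [this]
        rw [Finset.sum_sub_distrib]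
        ring
      rw [h1]
      have h2 := hgu (Γ κ) (subset_convexHull ℝ _ ⟨κ, rfl⟩)
      have h3 : ∑ i, γ κ i * b i ≤ |B| + 1 := by
        have := (le_abs_self _).trans (hB κ trivial)
        have := le_abs_self B
        linarith
      have h4 : ε * ∑ i, γ κ i * b i ≤ -u := by
        calc ε * ∑ i, γ κ i * b i ≤ ε * (|B| + 1) := mul_le_mul_of_nonneg_left h3 hε.le
          _ = -u := div_mul_cancel₀ _ (by positivity)
      linarith
  · left
    obtain ⟨x, hxD, t, ht, rfl⟩ := Set.not_disjoint_iff.mp hdisj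
    have hpos : ∀ x ∈ D, 0 < ∑ i, x.1 i * e i + x.2 := by
      have hconv : Convex ℝ {x : (Fin l → ℝ) × ℝ | 0 < ∑ i, x.1 i * e i + x.2} := by
        refine convex_halfSpace_gt ⟨fun x y => ?_, fun c x => ?_⟩ 0
        · simp only [Prod.fst_add, Prod.snd_add, Pi.add_apply, add_mul, Finset.sum_add_distrib]
          ring
        · simp only [Prod.smul_fst, Prod.smul_snd, Pi.smul_apply, smul_eq_mul, mul_add,
            Finset.mul_sum, mul_assoc]
      refine fun x hx => convexHull_min ?_ hconv hx
      rintro _ ⟨κ, rfl⟩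
      exact he κ
    -- The Slater direction `e` is positive on the whole hull, so the hull misses the origin and one
    -- may divide by `t`.
    have ht0 : 0 < t := by
      refine lt_of_le_of_ne ht fun h => ?_
      have := hpos _ hxD
      simp [← h] at this
    obtain ⟨ι, _, w, z, hw, -, hz, hwz⟩ := mem_convexHull_iff_exists_fintype.mp hxD
    choose κ hκ using hz
    refine ⟨ι, inferInstance, fun i => w i / t, κ, fun i => div_nonneg (hw i) ht, fun j => ?_, ?_⟩
    · have h1 := congrFun (congrArg Prod.fst hwz) j
      simp only [Prod.fst_sum, Finset.sum_apply, Prod.smul_fst, Pi.smul_apply, smul_eq_mul,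
        ← hκ] at h1
      have h2 : ∑ i, w i / t * γ (κ i) j = (∑ i, w i * γ (κ i) j) / t := by
        rw [Finset.sum_div]
        exact Finset.sum_congr rfl fun i _ => by ring
      rw [h2, div_eq_iff ht0.ne', mul_comm (b j)]
      exact h1
    · have h1 := congrArg Prod.snd hwz
      simp only [Prod.snd_sum, Prod.smul_snd, smul_eq_mul, ← hκ] at h1
      have h2 : ∑ i, w i / t * s (κ i) = (∑ i, w i * s (κ i)) / t := by
        rw [Finset.sum_div]
        exact Finset.sum_congr rfl fun i _ => by ring
      rw [h2, div_eq_iff ht0.ne', zero_mul]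
      simpa [β, Γ] using h1

/-- A linearized descent direction yields a feasible point with a smaller objective value. -/
theorem exists_feasible_descent {f : MvPolynomial (Fin l) ℝ} (hf : IsSOSConvex f)
    {c : K → MvPolynomial (Fin l) ℝ} (hc : ∀ κ, IsSOSConvex (-c κ))
    (hcont : Continuous fun p : K × (Fin l → ℝ) => eval p.2 (c p.1))
    (hcont' : ∀ i, Continuous fun p : K × (Fin l → ℝ) => eval p.2 (pderiv i (c p.1)))
    {y d : Fin l → ℝ} {τ : ℝ} (hy : ∀ κ, 0 ≤ eval y (c κ))
    (hd : ∑ i, eval y (pderiv i f) * d i < 0)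
    (hτ : ∀ κ, 0 < ∑ i, eval y (pderiv i (c κ)) * d i + τ * eval y (c κ)) :
    ∃ z, (∀ κ, 0 ≤ eval z (c κ)) ∧ eval z f < eval y f := by
  have hs : Continuous fun κ => eval y (c κ) :=
    hcont.comp (continuous_id.prodMk continuous_const)
  have hz : Continuous fun t : ℝ => y + t • d := by fun_prop
  -- Gradients are taken at the moved point, so that concavity alone gives feasibility. Replacing
  -- `τ` by `|τ| + 1` only helps, as the constraints are nonnegative at `y`; compactness of `K`
  -- makes the bound uniform in `κ`.
  have h1 : ∀ᶠ t in 𝓝 (0 : ℝ), ∀ κ ∈ (Set.univ : Set K),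
      0 < ∑ i, eval (y + t • d) (pderiv i (c κ)) * d i + (|τ| + 1) * eval y (c κ) := by
    refine isCompact_univ.eventually_forall_of_forall_eventually fun κ _ => ?_
    have hF : Continuous fun p : ℝ × K =>
        ∑ i, eval (y + p.1 • d) (pderiv i (c p.2)) * d i + (|τ| + 1) * eval y (c p.2) := by
      refine (continuous_finsetSum _ fun i _ => Continuous.mul ?_ continuous_const).add
        (continuous_const.mul (hs.comp continuous_snd))
      have h := (hcont' i).comp (f := fun p : ℝ × K => (p.2, y + p.1 • d)) (by fun_prop)
      exact h
    have h2 := hτ κ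
    have h3 : τ * eval y (c κ) ≤ (|τ| + 1) * eval y (c κ) :=
      mul_le_mul_of_nonneg_right (by linarith [le_abs_self τ]) (hy κ)
    refine (hF.tendsto (0, κ)).eventually_const_lt ?_
    simp only [zero_smul, add_zero]
    linarith
  have h2 : ∀ᶠ t in 𝓝 (0 : ℝ), ∑ i, eval (y + t • d) (pderiv i f) * d i < 0 := by
    have hF : Continuous fun t : ℝ => ∑ i, eval (y + t • d) (pderiv i f) * d i :=
      continuous_finsetSum _ fun i _ =>
        ((MvPolynomial.continuous_eval _).comp hz).mul continuous_const
    refine (hF.tendsto 0).eventually_lt_const ?_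
    simpa using hd
  have h3 : ∀ᶠ t in 𝓝 (0 : ℝ), t * (|τ| + 1) < 1 := by
    have hF : Continuous fun t : ℝ => t * (|τ| + 1) := by fun_prop
    refine (hF.tendsto 0).eventually_lt_const ?_
    simp
  obtain ⟨t, ⟨⟨h1, h2⟩, h3⟩, ht⟩ :=
    ((((h1.and h2).and h3).filter_mono nhdsWithin_le_nhds).and
      (self_mem_nhdsWithin : Set.Ioi (0 : ℝ) ∈ 𝓝[>] 0)).exists
  have ht : 0 < t := ht
  have hsum : ∀ p : MvPolynomial (Fin l) ℝ,
      ∑ i, eval (y + t • d) (pderiv i p) * (y i - (y + t • d) i) =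
        -(t * ∑ i, eval (y + t • d) (pderiv i p) * d i) := by
    intro p
    rw [Finset.mul_sum, ← Finset.sum_neg_distrib]
    refine Finset.sum_congr rfl fun i _ => ?_
    simp only [Pi.add_apply, Pi.smul_apply, smul_eq_mul]
    ring
  have hfeas : ∀ κ, 0 ≤ eval (y + t • d) (c κ) := by
    intro κ
    -- Concavity gives `c(z) ≥ c(y) + t ∇c(z)·d`, which exceeds `(1 - t(|τ| + 1)) c(y) ≥ 0`.
    have h4 := (hc κ).gradient_inequality (y + t • d) y
    simp only [map_neg, neg_mul, Finset.sum_neg_distrib] at h4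
    rw [hsum] at h4
    have h5 := mul_pos ht (h1 κ trivial)
    have h6 : 0 ≤ (1 - t * (|τ| + 1)) * eval y (c κ) :=
      mul_nonneg (by linarith) (hy κ)
    rw [mul_add, ← mul_assoc t (|τ| + 1)] at h5
    rw [sub_mul, one_mul] at h6
    linarith
  have h4 := hf.gradient_inequality (y + t • d) y
  rw [hsum] at h4
  have h5 := mul_neg_of_pos_of_neg ht h2
  exact ⟨_, hfeas, by linarith⟩

/-- A minimizer of an SOS-convex polynomial under a compact family of SOS-concave constraints with
a Slater point satisfies the Karush–Kuhn–Tucker conditions. -/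
theorem exists_kkt_multipliers {f : MvPolynomial (Fin l) ℝ} (hf : IsSOSConvex f)
    {c : K → MvPolynomial (Fin l) ℝ} (hc : ∀ κ, IsSOSConvex (-c κ))
    (hcont : Continuous fun p : K × (Fin l → ℝ) => eval p.2 (c p.1))
    (hcont' : ∀ i, Continuous fun p : K × (Fin l → ℝ) => eval p.2 (pderiv i (c p.1)))
    {y e : Fin l → ℝ} (hy : ∀ κ, 0 ≤ eval y (c κ))
    (hmin : ∀ z, (∀ κ, 0 ≤ eval z (c κ)) → eval y f ≤ eval z f)
    (he : ∀ κ, 0 < eval e (c κ)) :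
    ∃ (ι : Type) (_ : Fintype ι) (w : ι → ℝ) (κ : ι → K), (∀ i, 0 ≤ w i) ∧
      (∀ j, ∑ i, w i * eval y (pderiv j (c (κ i))) = eval y (pderiv j f)) ∧
      ∑ i, w i * eval y (c (κ i)) = 0 := by
  have hγ : Continuous fun κ => fun i => eval y (pderiv i (c κ)) :=
    continuous_pi fun i => by
      have h := (hcont' i).comp (f := fun κ => (κ, y)) (by fun_prop)
      exact h
  have hs : Continuous fun κ => eval y (c κ) :=
    hcont.comp (continuous_id.prodMk continuous_const)
  rcases exists_multipliers_or_direction (γ := fun κ i => eval y (pderiv i (c κ)))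
    (s := fun κ => eval y (c κ)) hγ hs (fun i => eval y (pderiv i f)) (e := e - y)
    (fun κ => by
      -- By concavity, `e - y` is strictly inward for the linearized constraints: their value along
      -- it is at least `c κ` at `e`.
      have h1 := (hc κ).gradient_inequality y e
      simp only [map_neg, neg_mul, Finset.sum_neg_distrib] at h1
      have h2 := he κ
      simp only [Pi.sub_apply]
      linarith) with h | ⟨d, τ, hd, hτ⟩
  · exact h
  obtain ⟨z, hz, hlt⟩ := exists_feasible_descent hf hc hcont hcont' hy hd hτ
  exact absurd (hmin z hz) (not_le.mpr hlt)

/-- The Lagrangian certificate of a minimizer is a sum of squares. -/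
theorem exists_isSOSPoly_lagrangian {f : MvPolynomial (Fin l) ℝ} (hf : IsSOSConvex f)
    {c : K → MvPolynomial (Fin l) ℝ} (hc : ∀ κ, IsSOSConvex (-c κ))
    (hcont : Continuous fun p : K × (Fin l → ℝ) => eval p.2 (c p.1))
    (hcont' : ∀ i, Continuous fun p : K × (Fin l → ℝ) => eval p.2 (pderiv i (c p.1)))
    {y e : Fin l → ℝ} (hy : ∀ κ, 0 ≤ eval y (c κ))
    (hmin : ∀ z, (∀ κ, 0 ≤ eval z (c κ)) → eval y f ≤ eval z f)
    (he : ∀ κ, 0 < eval e (c κ)) :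
    ∃ (ι : Type) (_ : Fintype ι) (w : ι → ℝ) (κ : ι → K), (∀ i, 0 ≤ w i) ∧
      IsSOSPoly (f - C (eval y f) - ∑ i, w i • c (κ i)) := by
  obtain ⟨ι, _, w, κ, hw, hgrad, hval⟩ := exists_kkt_multipliers hf hc hcont hcont' hy hmin he
  refine ⟨ι, inferInstance, w, κ, hw, ?_⟩
  let h := f - ∑ i, w i • c (κ i)
  have hh : IsSOSConvex h := by
    have : h = ∑ o : Option ι, o.elim 1 w • o.elim f fun i => -c (κ i) := by
      rw [Fintype.sum_option]
      simp [h, sub_eq_add_neg]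
    rw [this]
    refine IsSOSConvex.sum_smul (fun o => ?_) (fun o => ?_)
    · cases o
      exacts [hf, hc _]
    · cases o
      exacts [zero_le_one, hw _]
  -- By the KKT conditions the Lagrangian has zero gradient at `y` and value `f(y)`, so its Taylor
  -- remainder there is the certificate.
  have hrem : taylorRem y h = f - C (eval y f) - ∑ i, w i • c (κ i) := by
    have h1 : ∀ j, eval y (pderiv j h) = 0 := by
      intro j
      simp only [h, map_sub, map_sum, Derivation.map_smul, smul_eval]
      rw [hgrad, sub_self]
    have h2 : eval y h = eval y f := by
      simp only [h, map_sub, map_sum, smul_eval]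
      rw [hval, sub_zero]
    simp only [taylorRem, h1, h2, map_zero, zero_mul, Finset.sum_const_zero, sub_zero, h]
    ring
  rw [← hrem]
  exact isSOSPoly_taylorRem hh y

end Optimality

end RobustPMI

namespace RobustPMI

/-! ### Evaluation of quadratic modules -/

section QuadModule

theorem sum_mul_mul_eq_dotProduct {ι : Type*} [Fintype ι] (M : Matrix ι ι ℝ) (v : ι → ℝ) :
    ∑ i, ∑ j, v i * v j * M i j = v ⬝ᵥ M *ᵥ v := by
  simp only [dotProduct, Matrix.mulVec, Finset.mul_sum]
  exact Finset.sum_congr rfl fun i _ => Finset.sum_congr rfl fun j _ => by ring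

theorem trace_mul_vecMulVec_self {ι : Type*} [Fintype ι] (M : Matrix ι ι ℝ) (v : ι → ℝ) :
    (M * Matrix.vecMulVec v v).trace = ∑ i, ∑ j, v i * v j * M i j := by
  simp only [Matrix.trace, Matrix.diag_apply, Matrix.mul_apply, Matrix.vecMulVec_apply]
  exact Finset.sum_congr rfl fun i _ => Finset.sum_congr rfl fun j _ => by ring

theorem trace_mul_nonneg_of_posSemidef {ι : Type*} [Fintype ι] {M W : Matrix ι ι ℝ}
    (hM : M.PosSemidef) (hW : W.PosSemidef) : 0 ≤ (M * W).trace := by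
  obtain ⟨B, rfl⟩ := exists_eq_transpose_mul_self hW
  have h : Bᵀ * B = ∑ e, Matrix.vecMulVec (B e) (B e) := by
    ext i j
    simp [Matrix.mul_apply, Matrix.sum_apply, Matrix.vecMulVec_apply]
  rw [h, Finset.mul_sum, Matrix.trace_sum]
  refine Finset.sum_nonneg fun e _ => ?_
  rw [trace_mul_vecMulVec_self]
  exact sum_mul_mul_nonneg_of_posSemidef hM _

theorem blockPairing_apply {R : Type*} [CommRing R] {m q : ℕ}
    (A : Matrix (Fin m × Fin q) (Fin m × Fin q) R) (B : Matrix (Fin q) (Fin q) R) (i j : Fin m) :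
    blockPairing A B i j = ∑ a, ∑ b, A (j, b) (i, a) * B b a := by
  simp only [blockPairing, blockTrace, Matrix.of_apply, Matrix.mul_apply, Matrix.transpose_apply,
    Matrix.kroneckerMap_apply, Fintype.sum_prod_type, Matrix.one_apply]
  refine Finset.sum_congr rfl fun a _ => ?_
  rw [Finset.sum_eq_single j]
  · simp
  · intro c _ hc
    simp [hc]
  · simp

theorem IsSOSMatrix.exists_evalMat {n : ℕ} {ι : Type*} {F : Matrix ι ι (MvPolynomial (Fin n) ℝ)}
    (hF : IsSOSMatrix F) (x : Fin n → ℝ) :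
    ∃ (r : ℕ) (T : Matrix (Fin r) ι ℝ), ∀ i j, eval x (F i j) = ∑ e, T e i * T e j := by
  obtain ⟨r, T, rfl⟩ := hF
  exact ⟨r, T.map (eval x), fun i j => by simp [Matrix.mul_apply]⟩

/-- Writing `Sig1` as `Tᵀ T`, each row of `T` contracted with `v` gives a vector at which the form
`G(x)` is evaluated. -/
theorem sum_mul_mul_eval_nonneg_of_mem_quadModule {n m q k : ℕ}
    {G : Matrix (Fin q) (Fin q) (MvPolynomial (Fin n) ℝ)}
    {F : Matrix (Fin m) (Fin m) (MvPolynomial (Fin n) ℝ)} (hF : F ∈ quadModule m k G)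
    {x : Fin n → ℝ} (hx : (evalMat G x).PosSemidef) (v : Fin m → ℝ) :
    0 ≤ ∑ i, ∑ j, v i * v j * eval x (F i j) := by
  obtain ⟨A, B, hA, hB, -, -, rfl⟩ := hF
  obtain ⟨r, T, hT⟩ := hA.exists_evalMat x
  obtain ⟨r', T', hT'⟩ := hB.exists_evalMat x
  simp only [Matrix.add_apply, map_add, mul_add, Finset.sum_add_distrib]
  refine add_nonneg ?_ ?_
  · have h : ∑ i, ∑ j, v i * v j * eval x (A i j) = ∑ e, (∑ i, v i * T e i) ^ 2 := by
      simp_rw [hT, pow_two, Finset.sum_mul_sum, Finset.mul_sum]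
      conv_lhs =>
        enter [2, i]
        rw [Finset.sum_comm]
      rw [Finset.sum_comm]
      exact Finset.sum_congr rfl fun e _ => Finset.sum_congr rfl fun i _ =>
        Finset.sum_congr rfl fun j _ => by ring
    rw [h]
    positivity
  · have h : ∑ i, ∑ j, v i * v j * eval x (blockPairing B G i j) =
        ∑ e, ∑ b, ∑ a, (∑ j, v j * T' e (j, b)) * (∑ i, v i * T' e (i, a)) *
          evalMat G x b a := by
      simp_rw [blockPairing_apply, map_sum, map_mul, hT', Finset.sum_mul_sum, Finset.sum_mul,
        Finset.mul_sum]
      calc _ = ∑ i, ∑ j, ∑ e, ∑ b, ∑ a,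
            v i * v j * (T' e (j, b) * T' e (i, a) * eval x (G b a)) := by
            refine Finset.sum_congr rfl fun i _ => Finset.sum_congr rfl fun j _ => ?_
            rw [Finset.sum_comm]
            conv_lhs =>
              enter [2, b]
              rw [Finset.sum_comm]
            rw [Finset.sum_comm]
        _ = ∑ e, ∑ b, ∑ a, ∑ j, ∑ i,
            v i * v j * (T' e (j, b) * T' e (i, a) * eval x (G b a)) := by
            rw [Finset.sum_comm]
            conv_lhs =>
              enter [2, j]
              rw [Finset.sum_comm]
            rw [Finset.sum_comm]
            refine Finset.sum_congr rfl fun e _ => ?_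
            conv_lhs =>
              enter [2, j]
              rw [Finset.sum_comm]
            rw [Finset.sum_comm]
            refine Finset.sum_congr rfl fun b _ => ?_
            conv_lhs =>
              enter [2, j]
              rw [Finset.sum_comm]
            rw [Finset.sum_comm]
        _ = _ := by
            refine Finset.sum_congr rfl fun e _ => Finset.sum_congr rfl fun b _ =>
              Finset.sum_congr rfl fun a _ => Finset.sum_congr rfl fun j _ =>
              Finset.sum_congr rfl fun i _ => ?_
            rw [evalMat, Matrix.map_apply]
            ring
    rw [h]
    exact Finset.sum_nonneg fun e _ =>
      sum_mul_mul_nonneg_of_posSemidef hx fun b => ∑ j, v j * T' e (j, b)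

theorem eval_nonneg_of_mem_scalarQuadModule {l s k : ℕ} {θ : Fin s → MvPolynomial (Fin l) ℝ}
    {p : MvPolynomial (Fin l) ℝ} (hp : p ∈ scalarQuadModule k θ) {y : Fin l → ℝ}
    (hy : ∀ j, 0 ≤ eval y (θ j)) : 0 ≤ eval y p := by
  have hG : (evalMat (Matrix.diagonal θ) y).PosSemidef := by
    rw [evalMat, Matrix.diagonal_map (map_zero _)]
    exact Matrix.PosSemidef.diagonal fun j => hy j
  have := sum_mul_mul_eval_nonneg_of_mem_quadModule hp hG (fun _ => 1)
  simpa using this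

theorem add_sum_mem_scalarQuadModule {l s k : ℕ} {θ : Fin s → MvPolynomial (Fin l) ℝ}
    {h : MvPolynomial (Fin l) ℝ} (hh : IsSOSPoly h) (hdeg : h.totalDegree ≤ 2 * k)
    (hθ : ∀ j, (θ j).totalDegree ≤ 2 * k) {c : Fin s → ℝ} (hc : ∀ j, 0 ≤ c j) :
    h + ∑ j, c j • θ j ∈ scalarQuadModule k θ := by
  let T : Matrix (Fin s) (Fin 1 × Fin s) (MvPolynomial (Fin l) ℝ) :=
    Matrix.of fun a e => if a = e.2 then C (√(c a)) else 0
  have hpair : ∀ i j, blockPairing (Tᵀ * T) (Matrix.diagonal θ) i j = ∑ a, c a • θ a := by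
    intro i j
    rw [blockPairing_apply]
    refine Finset.sum_congr rfl fun a _ => ?_
    rw [Finset.sum_eq_single a]
    · rw [Matrix.diagonal_apply_eq, Matrix.mul_apply, Finset.sum_eq_single a]
      · simp only [T, Matrix.transpose_apply, Matrix.of_apply, if_true]
        rw [← C_mul, Real.mul_self_sqrt (hc a), C_mul']
      · intro b _ hb
        simp [T, hb]
      · simp
    · intro b _ hb
      rw [Matrix.diagonal_apply_ne _ hb, mul_zero]
    · simp
  refine ⟨Matrix.of fun _ _ => h, Tᵀ * T, hh.isSOSMatrix, ⟨s, T, rfl⟩, ?_, ?_, ?_⟩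
  · exact matDeg_le_iff.mpr fun _ _ => hdeg
  · refine matDeg_le_iff.mpr fun i j => ?_
    rw [hpair]
    exact totalDegree_finsetSum_le fun a _ => (totalDegree_smul_le _ _).trans (hθ a)
  · ext1 i j
    rw [Matrix.add_apply, hpair]
    rfl

end QuadModule

/-! ### Scalar moment sequences -/

section ScalarMoments

variable {l s : ℕ}

theorem scalarRiesz_eq_sum (u : (Fin l →₀ ℕ) → ℝ) {h : MvPolynomial (Fin l) ℝ}
    {t : Finset (Fin l →₀ ℕ)} (ht : h.support ⊆ t) :
    scalarRiesz u h = ∑ α ∈ t, coeff α h * u α :=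
  Finset.sum_subset ht fun α _ hα => by rw [notMem_support_iff.mp hα, zero_mul]

/-- The scalar Riesz functional as a linear map. -/
def scalarRieszHom (u : (Fin l →₀ ℕ) → ℝ) : MvPolynomial (Fin l) ℝ →ₗ[ℝ] ℝ where
  toFun := scalarRiesz u
  map_add' p q := by
    classical
    rw [scalarRiesz_eq_sum u support_add, scalarRiesz_eq_sum u Finset.subset_union_left,
      scalarRiesz_eq_sum u (h := q) Finset.subset_union_right, ← Finset.sum_add_distrib]
    exact Finset.sum_congr rfl fun α _ => by rw [coeff_add, add_mul]
  map_smul' c p := by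
    rw [scalarRiesz_eq_sum u support_smul, scalarRiesz, RingHom.id_apply, smul_eq_mul,
      Finset.mul_sum]
    exact Finset.sum_congr rfl fun α _ => by rw [coeff_smul, smul_eq_mul, mul_assoc]

theorem scalarRieszHom_apply (u : (Fin l →₀ ℕ) → ℝ) (h : MvPolynomial (Fin l) ℝ) :
    scalarRieszHom u h = scalarRiesz u h := rfl

theorem scalarRieszHom_monomial (u : (Fin l →₀ ℕ) → ℝ) (α : Fin l →₀ ℕ) (c : ℝ) :
    scalarRieszHom u (monomial α c) = c * u α := by
  classical
  rw [scalarRieszHom_apply, scalarRiesz_eq_sum u support_monomial_subset]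
  simp

theorem scalarRieszHom_X (u : (Fin l →₀ ℕ) → ℝ) (i : Fin l) :
    scalarRieszHom u (X i) = firstOrder u i := by
  rw [X, scalarRieszHom_monomial, one_mul]
  rfl

theorem scalarRieszHom_sq_nonneg {d : ℕ} {θ : Fin s → MvPolynomial (Fin l) ℝ}
    {u : (Fin l →₀ ℕ) → ℝ} (hu : u ∈ scalarMomentCone d θ) {g : MvPolynomial (Fin l) ℝ}
    (hg : g.totalDegree ≤ d) : 0 ≤ scalarRieszHom u (g ^ 2) := by
  have hsub : g.support ⊆ exps l d := fun α hα =>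
    mem_exps.mpr ((degree_le_totalDegree hα).trans hg)
  have hsum : g = ∑ α : exps l d, monomial α.1 (coeff α.1 g) := by
    rw [Finset.sum_coe_sort (exps l d) fun α => monomial α (coeff α g)]
    conv_lhs => rw [g.as_sum]
    refine Finset.sum_subset hsub fun α _ hα => ?_
    rw [notMem_support_iff.mp hα, monomial_zero]
  have h := sum_mul_mul_nonneg_of_posSemidef hu.2.1
    (fun e : exps l d × Fin 1 => coeff e.1.1 g)
  simp only [Fintype.sum_prod_type, Fin.sum_univ_one] at h
  refine h.trans_eq ?_
  conv_rhs => rw [hsum, pow_two, Finset.sum_mul_sum, map_sum]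
  refine Finset.sum_congr rfl fun α _ => ?_
  rw [map_sum]
  refine Finset.sum_congr rfl fun β _ => ?_
  rw [monomial_mul, scalarRieszHom_monomial]
  rfl

/-- The value is a diagonal entry of the localizing matrix, at exponent `0` and index `j`. -/
theorem scalarRieszHom_constraint_nonneg {d : ℕ} {θ : Fin s → MvPolynomial (Fin l) ℝ}
    {u : (Fin l →₀ ℕ) → ℝ} (hu : u ∈ scalarMomentCone d θ) (j : Fin s) :
    0 ≤ scalarRieszHom u (θ j) := by
  have h0 : (0 : Fin l →₀ ℕ) ∈ exps l (d - halfDeg (Matrix.diagonal θ)) :=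
    mem_exps.mpr (by simp)
  refine (hu.2.2.diag_nonneg (i := (⟨0, h0⟩, (0, j)))).trans_eq ?_
  rw [scalarRieszHom_apply, scalarRiesz_eq_sum u
    ((Matrix.diagonal_apply_eq θ j ▸ support_subset_matSupport (Matrix.diagonal θ) j j))]
  simp only [localizingMatrix, Matrix.of_apply, Matrix.sum_apply, Matrix.kroneckerMap_apply]
  refine Finset.sum_congr rfl fun γ _ => ?_
  simp [coeffMat, mul_comm]

/-- Squares in a sum of squares of degree at most `2d` have degree at most `d` at the root. -/
theorem totalDegree_le_of_sum_sq {r d : ℕ} {g : Fin r → MvPolynomial (Fin l) ℝ}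
    (h : (∑ i, g i ^ 2).totalDegree ≤ 2 * d) (i : Fin r) : (g i).totalDegree ≤ d := by
  by_contra! hlt
  let D := Finset.univ.sup fun i => (g i).totalDegree
  have hD : ∀ i, (g i).totalDegree ≤ D := fun i =>
    Finset.le_sup (f := fun i => (g i).totalDegree) (Finset.mem_univ i)
  -- Were some root too large, the squares of the leading components, of degree `2D > 2d`, would
  -- have to cancel; over the reals they cannot.
  have htop : ∀ i, homogeneousComponent (2 * D) (g i ^ 2) = homogeneousComponent D (g i) ^ 2 := by
    intro i
    conv_lhs => rw [← sum_homogeneousComponent_of_lt (Nat.lt_succ_of_le (hD i))]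
    have hmul : ∀ a b, homogeneousComponent (2 * D)
        (homogeneousComponent a (g i) * homogeneousComponent b (g i)) =
        if 2 * D = a + b then homogeneousComponent a (g i) * homogeneousComponent b (g i)
          else 0 := fun a b => homogeneousComponent_of_mem
      ((homogeneousComponent_isHomogeneous a (g i)).mul (homogeneousComponent_isHomogeneous b (g i)))
    rw [pow_two, Finset.sum_mul_sum, map_sum, Finset.sum_eq_single D, map_sum,
      Finset.sum_eq_single D, hmul, if_pos (two_mul D), pow_two]
    · intro b _ hb
      rw [hmul, if_neg (by omega)]
    · simp
    · intro a ha ha'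
      rw [map_sum]
      refine Finset.sum_eq_zero fun b hb => ?_
      rw [Finset.mem_range] at ha hb
      rw [hmul, if_neg (by omega)]
    · simp
  have hzero : ∑ i, homogeneousComponent D (g i) ^ 2 = 0 := by
    simp_rw [← htop]
    rw [← map_sum]
    refine homogeneousComponent_eq_zero _ _ (h.trans_lt ?_)
    have := hD i
    omega
  have hcomp : ∀ i, homogeneousComponent D (g i) = 0 := by
    intro i
    refine MvPolynomial.funext fun y => ?_
    have h1 := congrArg (eval y) hzero
    simp only [map_sum, map_pow, map_zero] at h1
    rw [Finset.sum_eq_zero_iff_of_nonneg fun i _ => sq_nonneg _] at h1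
    rw [map_zero]
    exact pow_eq_zero_iff two_ne_zero |>.mp (h1 i (Finset.mem_univ i))
  have hDpos : 0 < D := lt_of_lt_of_le (by omega) (hD i)
  obtain ⟨j, -, hj⟩ := Finset.exists_mem_eq_sup Finset.univ ⟨i, Finset.mem_univ i⟩
    fun i => (g i).totalDegree
  have hle : (g j).totalDegree ≤ D - 1 := by
    rw [← sum_homogeneousComponent_of_lt (Nat.lt_succ_of_le (hD j)), Finset.sum_range_succ, hcomp,
      add_zero]
    refine totalDegree_finsetSum_le fun a ha => ?_
    have := Finset.mem_range.mp ha
    exact (homogeneousComponent_isHomogeneous a (g j)).totalDegree_le.trans (by omega)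
  have : D = (g j).totalDegree := hj
  omega

/-- Jensen's inequality for SOS-convex polynomials and truncated pseudo-moment sequences. -/
theorem eval_firstOrder_le_scalarRieszHom {d : ℕ} {θ : Fin s → MvPolynomial (Fin l) ℝ}
    {u : (Fin l →₀ ℕ) → ℝ} (hu : u ∈ scalarMomentCone d θ) (hu1 : scalarRiesz u 1 = 1)
    {h : MvPolynomial (Fin l) ℝ} (hh : IsSOSConvex h) (hdeg : h.totalDegree ≤ 2 * d) :
    eval (firstOrder u) h ≤ scalarRieszHom u h := by
  obtain ⟨r, g, hg⟩ := isSOSPoly_taylorRem hh (firstOrder u)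
  have hgdeg := totalDegree_le_of_sum_sq (hg ▸ (totalDegree_taylorRem_le _ h).trans hdeg)
  have h1 : 0 ≤ scalarRieszHom u (taylorRem (firstOrder u) h) := by
    rw [hg, map_sum]
    exact Finset.sum_nonneg fun i _ => scalarRieszHom_sq_nonneg hu (hgdeg i)
  have hC : ∀ c, scalarRieszHom u (C c) = c := by
    intro c
    rw [← mul_one (C c), C_mul', map_smul, scalarRieszHom_apply, hu1, smul_eq_mul, mul_one]
  -- The linear part disappears because the base point is made of the first-order entries of `u`.
  have h2 : scalarRieszHom u (taylorRem (firstOrder u) h) =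
      scalarRieszHom u h - eval (firstOrder u) h := by
    rw [taylorRem, map_sub, map_sub, hC, map_sum]
    simp only [C_mul', map_smul, map_sub, scalarRieszHom_X, hC, sub_self, smul_zero,
      Finset.sum_const_zero, sub_zero]
  linarith

end ScalarMoments

end RobustPMI

namespace RobustPMI

/-! ### Riesz functionals and moment cones of atomic sequences -/

section AtomicSequences

variable {n m q : ℕ} {ι : Type*} [Fintype ι]

theorem riesz_eq_sum_trace {S : MatSeq n m} {W : ι → Matrix (Fin m) (Fin m) ℝ}
    {x : ι → Fin n → ℝ} {F : Matrix (Fin m) (Fin m) (MvPolynomial (Fin n) ℝ)}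
    (hS : ∀ α ∈ matSupport F, S α = ∑ i, powAt (x i) α • W i) :
    riesz S F = ∑ i, (evalMat F (x i) * W i).trace := by
  simp_rw [evalMat_eq_sum, Finset.sum_mul, Matrix.trace_sum]
  rw [Finset.sum_comm, riesz]
  refine Finset.sum_congr rfl fun α hα => ?_
  rw [hS α hα, Finset.mul_sum, Matrix.trace_sum]
  exact Finset.sum_congr rfl fun i _ => by rw [Matrix.mul_smul, Matrix.smul_mul]

/-- The alternative `v i = 0` admits placeholder atoms outside the uncertainty set; they come from
the multipliers of the `θ_j`. -/
theorem mem_momentCone_of_atoms {G : Matrix (Fin q) (Fin q) (MvPolynomial (Fin n) ℝ)} (k : ℕ)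
    {S : MatSeq n m} {w : ι → ℝ} (hw : ∀ i, 0 ≤ w i) {x : ι → Fin n → ℝ} {v : ι → Fin m → ℝ}
    (hx : ∀ i, v i = 0 ∨ (evalMat G (x i)).PosSemidef)
    (hS : ∀ α, S α = ∑ i, powAt (x i) α • w i • Matrix.vecMulVec (v i) (v i)) :
    S ∈ momentCone m k G := by
  have hSapp : ∀ α a b, S α a b = ∑ i, w i * (powAt (x i) α * (v i a * v i b)) := by
    intro α a b
    rw [hS, Matrix.sum_apply]
    refine Finset.sum_congr rfl fun i _ => ?_
    simp only [Matrix.smul_apply, Matrix.vecMulVec_apply, smul_eq_mul]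
    ring
  have hvec : ∀ {κ : Type} [Finite κ] (z : κ → ℝ), (Matrix.vecMulVec z z).PosSemidef := by
    intro κ _ z
    simpa using Matrix.posSemidef_vecMulVec_self_star z
  refine ⟨fun α _ => ?_, ?_, ?_⟩
  · ext a b
    rw [Matrix.transpose_apply, hSapp, hSapp]
    exact Finset.sum_congr rfl fun i _ => by ring
  · have h : momentMatrix k S = ∑ i, w i • Matrix.vecMulVec
        (fun e : exps n k × Fin m => powAt (x i) e.1.1 * v i e.2)
        (fun e : exps n k × Fin m => powAt (x i) e.1.1 * v i e.2) := by
      ext e e'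
      rw [Matrix.sum_apply, momentMatrix, Matrix.of_apply, hSapp]
      refine Finset.sum_congr rfl fun i _ => ?_
      rw [Matrix.smul_apply, Matrix.vecMulVec_apply, powAt_add, smul_eq_mul]
      ring
    rw [h]
    exact Matrix.posSemidef_sum _ fun i _ => (hvec _).smul (hw i)
  · have h : localizingMatrix (k - halfDeg G) G S = ∑ i, w i • (Matrix.vecMulVec
        (fun e : exps n (k - halfDeg G) × Fin m => powAt (x i) e.1.1 * v i e.2)
        (fun e : exps n (k - halfDeg G) × Fin m => powAt (x i) e.1.1 * v i e.2) ⊗ₖ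
          evalMat G (x i)).submatrix (Equiv.prodAssoc _ _ _).symm (Equiv.prodAssoc _ _ _).symm := by
      ext ⟨α, a, b⟩ ⟨α', a', b'⟩
      rw [Matrix.sum_apply]
      simp only [localizingMatrix, Matrix.of_apply, Matrix.sum_apply, Matrix.kroneckerMap_apply,
        hSapp, Matrix.smul_apply, Matrix.submatrix_apply, Equiv.prodAssoc_symm_apply,
        Matrix.vecMulVec_apply, smul_eq_mul]
      simp_rw [evalMat_eq_sum, Matrix.sum_apply, Finset.sum_mul, Finset.mul_sum]
      rw [Finset.sum_comm]
      refine Finset.sum_congr rfl fun i _ => Finset.sum_congr rfl fun γ _ => ?_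
      simp only [Matrix.smul_apply, powAt_add, smul_eq_mul]
      ring
    rw [h]
    refine Matrix.posSemidef_sum _ fun i _ => Matrix.PosSemidef.smul ?_ (hw i)
    rcases hx i with h0 | hG
    · have : (Matrix.vecMulVec
        (fun e : exps n (k - halfDeg G) × Fin m => powAt (x i) e.1.1 * v i e.2)
        (fun e : exps n (k - halfDeg G) × Fin m => powAt (x i) e.1.1 * v i e.2) ⊗ₖ
          evalMat G (x i)) = 0 := by
        ext e e'
        simp [h0, Matrix.vecMulVec_apply]
      rw [this]
      exact Matrix.PosSemidef.zero
    · exact ((hvec _).kronecker hG).submatrix _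

end AtomicSequences

theorem continuous_eval_map {n l : ℕ} (Q : MvPolynomial (Fin l) (MvPolynomial (Fin n) ℝ)) :
    Continuous fun z : (Fin n → ℝ) × (Fin l → ℝ) => eval z.2 (MvPolynomial.map (eval z.1) Q) := by
  induction Q using MvPolynomial.induction_on with
  | C c =>
    simp only [map_C, eval_C]
    exact (MvPolynomial.continuous_eval c).comp continuous_fst
  | add p q hp hq =>
    simp only [map_add]
    exact hp.add hq
  | mul_X p i hp =>
    simp only [map_mul, map_X, eval_X]
    exact hp.mul ((continuous_apply i).comp continuous_snd)

theorem le_two_mul_ceilHalf (d : ℕ) : d ≤ 2 * ceilHalf d := by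
  rw [ceilHalf]; omega

end RobustPMI

namespace RPMIO

open RobustPMI

variable {l n m q s : ℕ} (p : RPMIO l n m q s)

/-! ### The data of the problem -/

section Data

theorem PEval_apply (y : Fin l → ℝ) (x : Fin n → ℝ) (i j : Fin m) :
    p.PEval y x i j = eval y (MvPolynomial.map (eval x) (p.P i j)) := rfl

theorem PAt_apply (x : Fin n → ℝ) (i j : Fin m) :
    p.PAt x i j = MvPolynomial.map (eval x) (p.P i j) := rfl

theorem support_PAt_subset (x : Fin n → ℝ) (i j : Fin m) :
    (p.PAt x i j).support ⊆ (p.P i j).support := by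
  rw [PAt_apply]
  exact support_map_subset _ _

theorem totalDegree_PAt_le (x : Fin n → ℝ) (i j : Fin m) :
    (p.PAt x i j).totalDegree ≤ matDeg p.P :=
  (Finset.sup_mono (p.support_PAt_subset x i j)).trans (totalDegree_le_matDeg p.P i j)

theorem PEval_eq_sum (y : Fin l → ℝ) (x : Fin n → ℝ) :
    p.PEval y x = ∑ β ∈ matSupport p.P, powAt y β • evalMat (coeffMat p.P β) x := by
  ext i j
  rw [PEval_apply, eval_eq_sum_powAt y
    ((support_map_subset _ _).trans (support_subset_matSupport p.P i j)), Matrix.sum_apply]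
  refine Finset.sum_congr rfl fun β _ => ?_
  rw [coeff_map, mul_comm]
  rfl

theorem PEval_isSymm (y : Fin l → ℝ) (x : Fin n → ℝ) : (p.PEval y x).IsSymm := by
  ext i j
  rw [Matrix.transpose_apply, PEval_apply, PEval_apply, p.P_symm.apply]

theorem totalDegree_f_le : p.f.totalDegree ≤ 2 * ceilHalf p.kY :=
  (le_max_left _ _).trans (le_two_mul_ceilHalf _)

theorem totalDegree_θ_le (j : Fin s) : (p.θ j).totalDegree ≤ 2 * ceilHalf p.kY :=
  (Finset.le_sup (f := fun j => (p.θ j).totalDegree) (Finset.mem_univ j)).trans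
    (((le_max_left _ _).trans (le_max_right _ _)).trans (le_two_mul_ceilHalf _))

theorem matDeg_P_le : matDeg p.P ≤ 2 * ceilHalf p.kY :=
  ((le_max_right _ _).trans (le_max_right _ _)).trans (le_two_mul_ceilHalf _)

theorem degree_le_kX {β : Fin l →₀ ℕ} (hβ : β ∈ matSupport p.P) {α : Fin n →₀ ℕ}
    (hα : α ∈ matSupport (coeffMat p.P β)) : α.degree ≤ p.kX :=
  (degree_le_matDeg hα).trans ((Finset.le_sup (f := fun β => matDeg (coeffMat p.P β)) hβ).trans
    (le_max_left _ _))

theorem halfDeg_le : halfDeg p.G ≤ ceilHalf p.kX :=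
  Nat.div_le_div_right (Nat.add_le_add_right (le_max_right _ _) 1)

theorem eval_rieszP {ι : Type*} [Fintype ι] {S : MatSeq n m}
    {W : ι → Matrix (Fin m) (Fin m) ℝ} {x : ι → Fin n → ℝ}
    (hS : ∀ α : Fin n →₀ ℕ, α.degree ≤ p.kX → S α = ∑ i, powAt (x i) α • W i)
    (y : Fin l → ℝ) : eval y (p.rieszP S) = ∑ i, (p.PEval y (x i) * W i).trace := by
  rw [rieszP, map_sum]
  simp_rw [PEval_eq_sum, Finset.sum_mul, Matrix.trace_sum]
  rw [Finset.sum_comm]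
  refine Finset.sum_congr rfl fun β hβ => ?_
  rw [eval_monomial_eq_powAt, riesz_eq_sum_trace fun α hα => hS α (p.degree_le_kX hβ hα),
    Finset.sum_mul]
  refine Finset.sum_congr rfl fun i _ => ?_
  rw [Matrix.smul_mul, Matrix.trace_smul, smul_eq_mul, mul_comm]

/-- The polynomial `vᵀ P(·, x) v`. -/
def quadPoly (x : Fin n → ℝ) (v : Fin m → ℝ) : MvPolynomial (Fin l) ℝ :=
  ∑ i, ∑ j, C (v i * v j) * p.PAt x i j

theorem eval_quadPoly (x : Fin n → ℝ) (v : Fin m → ℝ) (y : Fin l → ℝ) :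
    eval y (p.quadPoly x v) = ∑ i, ∑ j, v i * v j * p.PEval y x i j := by
  simp only [quadPoly, map_sum, map_mul, eval_C]
  rfl

theorem totalDegree_quadPoly_le (x : Fin n → ℝ) (v : Fin m → ℝ) :
    (p.quadPoly x v).totalDegree ≤ 2 * ceilHalf p.kY := by
  refine totalDegree_finsetSum_le fun i _ => totalDegree_finsetSum_le fun j _ => ?_
  rw [C_mul']
  exact (totalDegree_smul_le _ _).trans ((p.totalDegree_PAt_le x i j).trans p.matDeg_P_le)

theorem isSOSConvex_neg_quadPoly (hp : p.SOSConvexData) {x : Fin n → ℝ} (hx : x ∈ p.X)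
    (v : Fin m → ℝ) : IsSOSConvex (-p.quadPoly x v) := by
  have := hp.P_convex x hx v
  simpa [quadPoly] using this

/-- Applying `u` in the variables `y` commutes with evaluating at `x`; this links Jensen's
inequality to the dual constraint. -/
theorem scalarRieszHom_quadPoly (u : (Fin l →₀ ℕ) → ℝ) (x : Fin n → ℝ) (v : Fin m → ℝ) :
    scalarRieszHom u (p.quadPoly x v) =
      ∑ i, ∑ j, v i * v j * eval x (p.scalarRieszP u i j) := by
  simp only [quadPoly, map_sum, C_mul', map_smul, smul_eq_mul]
  refine Finset.sum_congr rfl fun i _ => Finset.sum_congr rfl fun j _ => ?_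
  congr 1
  rw [scalarRieszHom_apply, scalarRiesz_eq_sum u
    ((p.support_PAt_subset x i j).trans (support_subset_matSupport p.P i j)),
    scalarRieszP, Matrix.sum_apply, map_sum]
  refine Finset.sum_congr rfl fun β _ => ?_
  rw [Matrix.smul_apply, smul_eval, mul_comm, PAt_apply, coeff_map]
  rfl

theorem continuous_eval_quadPoly : Continuous fun z : ((Fin n → ℝ) × (Fin m → ℝ)) × (Fin l → ℝ) =>
    eval z.2 (p.quadPoly z.1.1 z.1.2) := by
  simp only [eval_quadPoly]
  refine continuous_finsetSum _ fun i _ => continuous_finsetSum _ fun j _ => ?_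
  refine Continuous.mul (by fun_prop) ?_
  exact (continuous_eval_map (p.P i j)).comp
    (f := fun z : ((Fin n → ℝ) × (Fin m → ℝ)) × (Fin l → ℝ) => (z.1.1, z.2)) (by fun_prop)

theorem pderiv_quadPoly (e : Fin l) (x : Fin n → ℝ) (v : Fin m → ℝ) :
    pderiv e (p.quadPoly x v) =
      ∑ i, ∑ j, C (v i * v j) * MvPolynomial.map (eval x) (pderiv e (p.P i j)) := by
  simp only [quadPoly, map_sum]
  refine Finset.sum_congr rfl fun i _ => Finset.sum_congr rfl fun j _ => ?_
  rw [pderiv_C_mul, PAt_apply, pderiv_map]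

theorem continuous_eval_pderiv_quadPoly (e : Fin l) :
    Continuous fun z : ((Fin n → ℝ) × (Fin m → ℝ)) × (Fin l → ℝ) =>
      eval z.2 (pderiv e (p.quadPoly z.1.1 z.1.2)) := by
  simp only [pderiv_quadPoly, map_sum, map_mul, eval_C]
  refine continuous_finsetSum _ fun i _ => continuous_finsetSum _ fun j _ => ?_
  refine Continuous.mul (by fun_prop) ?_
  exact (continuous_eval_map (pderiv e (p.P i j))).comp
    (f := fun z : ((Fin n → ℝ) × (Fin m → ℝ)) × (Fin l → ℝ) => (z.1.1, z.2)) (by fun_prop)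

end Data

end RPMIO

namespace RPMIO

open RobustPMI

variable {l n m q s : ℕ} (p : RPMIO l n m q s)

/-! ### The constraints as a compact family -/

section Constraints

/-- The index set of the scalar constraints: pairs of a point of `X` and a unit vector, and the
indices of the `θ_j`. -/
abbrev ConstraintIndex : Type :=
  (p.X × Metric.sphere (0 : Fin m → ℝ) 1) ⊕ Fin s

/-- The scalar constraints `vᵀ P(·, x) v ≥ 0` and `θ_j ≥ 0`. -/
def constraint : p.ConstraintIndex → MvPolynomial (Fin l) ℝ :=
  Sum.elim (fun e => p.quadPoly e.1 e.2) p.θ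

theorem mem_feasible_iff (y : Fin l → ℝ) :
    y ∈ p.feasible ↔ ∀ κ, 0 ≤ eval y (p.constraint κ) := by
  constructor
  · rintro ⟨hY, hP⟩ (⟨x, v⟩ | j)
    · change 0 ≤ eval y (p.quadPoly x v)
      rw [eval_quadPoly]
      exact sum_mul_mul_nonneg_of_posSemidef (hP x x.2) _
    · exact hY j
  · intro h
    refine ⟨fun j => h (Sum.inr j), fun x hx => ?_⟩
    refine posSemidef_of_sum_mul_mul_nonneg (p.PEval_isSymm y x) fun v => ?_
    by_cases hv : v = 0
    · simp [hv]
    have hn : ‖v‖ ≠ 0 := norm_ne_zero_iff.mpr hv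
    -- The sphere is that of the sup norm on `Fin m → ℝ`; only compactness and homogeneity matter.
    have hmem : ‖v‖⁻¹ • v ∈ Metric.sphere (0 : Fin m → ℝ) 1 := by
      rw [mem_sphere_zero_iff_norm, norm_smul, norm_inv, norm_norm, inv_mul_cancel₀ hn]
    have h1 : 0 ≤ eval y (p.quadPoly x (‖v‖⁻¹ • v)) := h (Sum.inl (⟨x, hx⟩, ⟨_, hmem⟩))
    rw [eval_quadPoly] at h1
    have h2 : ∑ i, ∑ j, v i * v j * p.PEval y x i j = ‖v‖ ^ 2 *
        ∑ i, ∑ j, (‖v‖⁻¹ • v) i * (‖v‖⁻¹ • v) j * p.PEval y x i j := by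
      rw [Finset.mul_sum]
      refine Finset.sum_congr rfl fun i _ => ?_
      rw [Finset.mul_sum]
      refine Finset.sum_congr rfl fun j _ => ?_
      rw [Pi.smul_apply, Pi.smul_apply, smul_eq_mul, smul_eq_mul]
      field_simp
    rw [h2]
    positivity

theorem constraint_pos_of_slater {y : Fin l → ℝ} (hθ : ∀ j, 0 < eval y (p.θ j))
    (hP : ∀ x ∈ p.X, (p.PEval y x).PosDef) (κ : p.ConstraintIndex) :
    0 < eval y (p.constraint κ) := by
  rcases κ with ⟨x, v⟩ | j
  · change 0 < eval y (p.quadPoly x v)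
    have hv : v.1 ≠ 0 := by
      intro h
      have := v.2
      rw [mem_sphere_zero_iff_norm, h, norm_zero] at this
      exact zero_ne_one this
    rw [eval_quadPoly, sum_mul_mul_eq_dotProduct]
    have := (hP x x.2).dotProduct_mulVec_pos hv
    rwa [star_trivial] at this
  · exact hθ j

theorem isSOSConvex_neg_constraint (hp : p.SOSConvexData) (κ : p.ConstraintIndex) :
    IsSOSConvex (-p.constraint κ) := by
  rcases κ with ⟨x, v⟩ | j
  · exact p.isSOSConvex_neg_quadPoly hp x.2 v
  · exact hp.θ_convex j

theorem continuous_sum_prod {A B C D : Type*} [TopologicalSpace A] [TopologicalSpace B]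
    [TopologicalSpace C] [TopologicalSpace D] [DiscreteTopology B] {F : (A ⊕ B) × C → D}
    (h1 : Continuous fun z : A × C => F (Sum.inl z.1, z.2))
    (h2 : ∀ b, Continuous fun z : C => F (Sum.inr b, z)) : Continuous F := by
  rw [← (Homeomorph.sumProdDistrib (X := A) (Y := B) (Z := C)).symm.comp_continuous_iff']
  refine continuous_sum_dom.mpr ⟨h1, ?_⟩
  exact continuous_prod_of_discrete_left.mpr h2

theorem continuous_eval_constraint :
    Continuous fun z : p.ConstraintIndex × (Fin l → ℝ) => eval z.2 (p.constraint z.1) := by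
  refine continuous_sum_prod ?_ fun j => MvPolynomial.continuous_eval (p.θ j)
  exact p.continuous_eval_quadPoly.comp
    (f := fun z : (p.X × Metric.sphere (0 : Fin m → ℝ) 1) × (Fin l → ℝ) =>
      ((z.1.1.1, z.1.2.1), z.2)) (by fun_prop)

theorem continuous_eval_pderiv_constraint (e : Fin l) :
    Continuous fun z : p.ConstraintIndex × (Fin l → ℝ) =>
      eval z.2 (pderiv e (p.constraint z.1)) := by
  refine continuous_sum_prod ?_ fun j => MvPolynomial.continuous_eval (pderiv e (p.θ j))
  exact (p.continuous_eval_pderiv_quadPoly e).comp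
    (f := fun z : (p.X × Metric.sphere (0 : Fin m → ℝ) 1) × (Fin l → ℝ) =>
      ((z.1.1.1, z.1.2.1), z.2)) (by fun_prop)

end Constraints

/-! ### The primal and the dual relaxation -/

section Relaxations

variable {p}

/-- Weak duality: the certificate is evaluated at `y`. Atoms are needed only up to degree `k_x`, so
a truncated representation suffices. -/
theorem PrimalFeasible.add_sum_trace_le {ι : Type*} [Fintype ι] {k : ℕ} {ρ : ℝ} {S : MatSeq n m}
    (hS : p.PrimalFeasible k ρ S) {W : ι → Matrix (Fin m) (Fin m) ℝ} {x : ι → Fin n → ℝ}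
    (hW : ∀ α : Fin n →₀ ℕ, α.degree ≤ p.kX → S α = ∑ i, powAt (x i) α • W i) {y : Fin l → ℝ}
    (hy : y ∈ p.Y) : ρ + ∑ i, (p.PEval y (x i) * W i).trace ≤ eval y p.f := by
  have h := eval_nonneg_of_mem_scalarQuadModule hS.1 hy
  rw [map_sub, map_sub, eval_C, p.eval_rieszP hW] at h
  linarith

/-- Strong duality: an optimal solution is certified by a finitely atomic measure. -/
theorem IsOptimal.exists_primalFeasible (hp : p.SOSConvexData) (hs : p.Slater) {y : Fin l → ℝ}
    (hy : p.IsOptimal y) (k : ℕ) : ∃ S : MatSeq n m, p.PrimalFeasible k (eval y p.f) S := by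
  classical
  obtain ⟨e, heθ, heP⟩ := hs
  have : CompactSpace p.X := isCompact_iff_compactSpace.mp hp.X_compact
  obtain ⟨ι, _, w, κ, hw, hsos⟩ := exists_isSOSPoly_lagrangian (c := p.constraint) hp.f_convex
    (p.isSOSConvex_neg_constraint hp) p.continuous_eval_constraint
    p.continuous_eval_pderiv_constraint ((p.mem_feasible_iff y).mp hy.1)
    (fun z hz => hy.2 z ((p.mem_feasible_iff z).mpr hz)) (p.constraint_pos_of_slater heθ heP)
  -- The multipliers split in two: those at pairs `(x, v)` become the atoms of `S`, those at the
  -- `θ_j` are collected in `c`. Indices of the second kind get the vector `0`, so their filler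
  -- point does not contribute.
  let x : ι → Fin n → ℝ := fun i => Sum.elim (fun e => e.1.1) (fun _ => 0) (κ i)
  let v : ι → Fin m → ℝ := fun i => Sum.elim (fun e => e.2.1) (fun _ => 0) (κ i)
  let c : Fin s → ℝ := fun j => ∑ i, if κ i = Sum.inr j then w i else 0
  let S : MatSeq n m := fun α => ∑ i, powAt (x i) α • w i • Matrix.vecMulVec (v i) (v i)
  refine ⟨S, ?_, mem_momentCone_of_atoms k hw (fun i => ?_) fun α => rfl⟩
  · have hsum : ∑ i, w i • p.constraint (κ i) = p.rieszP S + ∑ j, c j • p.θ j := by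
      refine MvPolynomial.funext fun z => ?_
      rw [map_add, p.eval_rieszP (W := fun i => w i • Matrix.vecMulVec (v i) (v i)) (x := x)
        (fun α _ => rfl)]
      simp only [map_sum, smul_eval, c, Finset.sum_mul]
      rw [Finset.sum_comm, ← Finset.sum_add_distrib]
      refine Finset.sum_congr rfl fun i _ => ?_
      rw [Matrix.mul_smul, Matrix.trace_smul, trace_mul_vecMulVec_self, smul_eq_mul]
      rcases hκ : κ i with e | j
      · simp [x, v, hκ, constraint, eval_quadPoly]
      · simp [v, hκ, constraint]
    have hmem := add_sum_mem_scalarQuadModule (θ := p.θ) (k := ceilHalf p.kY) hsos ?_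
      p.totalDegree_θ_le (c := c) (fun j => Finset.sum_nonneg fun i _ => by
        split_ifs
        exacts [hw i, le_rfl])
    · convert hmem using 1
      rw [hsum]
      ring
    · refine (totalDegree_sub _ _).trans (max_le ((totalDegree_sub _ _).trans
        (max_le p.totalDegree_f_le (by simp))) ?_)
      refine totalDegree_finsetSum_le fun i _ => (totalDegree_smul_le _ _).trans ?_
      rcases κ i with e | j
      exacts [p.totalDegree_quadPoly_le _ _, p.totalDegree_θ_le j]
  · rcases hκ : κ i with e | j
    · right
      simp only [x, hκ, Sum.elim_inl]
      exact e.1.2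
    · left
      simp [v, hκ]

/-- Jensen's inequality for `-θ_j` and `-vᵀ P(·, x) v` bounds the values at `firstOrder u` below by
pseudo-moments, which the localizing matrix and the quadratic module make nonnegative. -/
theorem DualFeasible.firstOrder_mem_feasible (hp : p.SOSConvexData) {k : ℕ}
    {u : (Fin l →₀ ℕ) → ℝ} (hu : p.DualFeasible k u) : firstOrder u ∈ p.feasible := by
  obtain ⟨hu0, hu1, huP⟩ := hu
  refine ⟨fun j => ?_, fun x hx => posSemidef_of_sum_mul_mul_nonneg (p.PEval_isSymm _ x) fun v => ?_⟩
  · have h1 := eval_firstOrder_le_scalarRieszHom hu0 hu1 (hp.θ_convex j)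
      (by rw [totalDegree_neg]; exact p.totalDegree_θ_le j)
    rw [map_neg, map_neg] at h1
    have h2 := scalarRieszHom_constraint_nonneg hu0 j
    linarith
  · have h1 := eval_firstOrder_le_scalarRieszHom hu0 hu1 (p.isSOSConvex_neg_quadPoly hp hx v)
      (by rw [totalDegree_neg]; exact p.totalDegree_quadPoly_le x v)
    rw [map_neg, map_neg, eval_quadPoly, scalarRieszHom_quadPoly] at h1
    have h2 := sum_mul_mul_eval_nonneg_of_mem_quadModule huP hx v
    linarith

theorem DualFeasible.eval_firstOrder_le (hp : p.SOSConvexData) {k : ℕ}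
    {u : (Fin l →₀ ℕ) → ℝ} (hu : p.DualFeasible k u) :
    eval (firstOrder u) p.f ≤ scalarRiesz u p.f :=
  eval_firstOrder_le_scalarRieszHom hu.1 hu.2.1 hp.f_convex p.totalDegree_f_le

theorem IsOptimal.optValue_eq {y : Fin l → ℝ} (hy : p.IsOptimal y) :
    p.optValue = ((eval y p.f : ℝ) : EReal) :=
  le_antisymm (iInf₂_le y hy.1) (le_iInf₂ fun z hz => EReal.coe_le_coe_iff.mpr (hy.2 z hz))

theorem PrimalFeasible.le_primalValue {k : ℕ} {ρ : ℝ} {S : MatSeq n m}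
    (hS : p.PrimalFeasible k ρ S) : (ρ : EReal) ≤ p.primalValue k :=
  le_iSup_of_le ρ (le_iSup_of_le S (le_iSup_of_le hS le_rfl))

end Relaxations

end RPMIO

/-! ### Exactness under flat extension, recovery of a minimizer, and complementary slackness -/

theorem mainTheorem7 {l n m q s : ℕ} (p : RPMIO l n m q s)
    (hopt : ∃ y, p.IsOptimal y)
    (hG : 0 < RobustPMI.matDeg p.G)
    (k : ℕ) (ρ : ℝ) (S : RobustPMI.MatSeq n m) (hS : p.PrimalOptimal k ρ S)
    (t : ℕ) (ht : RobustPMI.ceilHalf p.kX ≤ t) (htk : t ≤ k)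
    (hFEC : (RobustPMI.momentMatrix t S).rank =
      (RobustPMI.momentMatrix (t - RobustPMI.halfDeg p.G) S).rank) :
    (∃ (r : ℕ) (W : Fin r → Matrix (Fin m) (Fin m) ℝ) (x : Fin r → p.X),
      RobustPMI.AtomicRepresentation (2 * t) S W x) ∧
    p.primalValue k ≤ p.optValue ∧
    (p.SOSConvexData → p.Slater →
      p.primalValue k = p.optValue ∧
      (p.primalValue k = p.dualValue k →
        p.dualValue k = p.optValue ∧
        ∀ u : (Fin l →₀ ℕ) → ℝ, p.DualOptimal k u →
          p.IsOptimal (RobustPMI.firstOrder u) ∧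
          ∀ (r : ℕ) (W : Fin r → Matrix (Fin m) (Fin m) ℝ) (x : Fin r → p.X),
            RobustPMI.AtomicRepresentation (2 * t) S W x →
            ∀ (i : Fin r) (d : ℕ) (v : Fin d → Fin m → ℝ),
              W i = ∑ j, Matrix.vecMulVec (v j) (v j) →
              ∀ j, (p.PEval (RobustPMI.firstOrder u) (x i)).mulVec (v j) = 0)) := by
  open RobustPMI in
  obtain ⟨y, hy⟩ := hopt
  obtain ⟨hSfeas, hρ⟩ := hS
  have hkX : p.kX ≤ 2 * t := by
    have := le_two_mul_ceilHalf p.kX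
    omega
  -- Stated for an arbitrary atomic representation, since the last claim concerns all of them and
  -- not just the one constructed.
  have hrep : ∀ {r : ℕ} {W : Fin r → Matrix (Fin m) (Fin m) ℝ} {x : Fin r → p.X},
      AtomicRepresentation (2 * t) S W x → ∀ z ∈ p.feasible,
        (∀ i, 0 ≤ (p.PEval z (x i) * W i).trace) ∧
          ρ + ∑ i, (p.PEval z (x i) * W i).trace ≤ eval z p.f := by
    intro r W x hx z hz
    obtain ⟨-, hW, hSW⟩ := atomicRepresentation_iff.mp hx
    exact ⟨fun i => trace_mul_nonneg_of_posSemidef (hz.2 _ (x i).2) (hW i),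
      hSfeas.add_sum_trace_le (x := fun i => (x i).1)
        (fun α hα => hSW α (mem_exps.mpr (hα.trans hkX))) hz.1⟩
  have hatoms : ∃ (r : ℕ) (W : Fin r → Matrix (Fin m) (Fin m) ℝ) (x : Fin r → p.X),
      AtomicRepresentation (2 * t) S W x :=
    exists_atomicRepresentation_of_flat p.G_symm hG hSfeas.2 (p.halfDeg_le.trans ht) htk hFEC
  have hle : p.primalValue k ≤ p.optValue := by
    obtain ⟨r, W, x, hx⟩ := hatoms
    obtain ⟨h1, h2⟩ := hrep hx y hy.1
    rw [← hρ, hy.optValue_eq, EReal.coe_le_coe_iff]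
    have := Finset.sum_nonneg fun i (_ : i ∈ Finset.univ) => h1 i
    linarith
  refine ⟨hatoms, hle, fun hp hs => ?_⟩
  have hval : p.primalValue k = p.optValue := by
    obtain ⟨S', hS'⟩ := hy.exists_primalFeasible hp hs k
    exact le_antisymm hle (hy.optValue_eq.trans_le hS'.le_primalValue)
  refine ⟨hval, fun hpd => ⟨hpd.symm.trans hval, fun u hu => ?_⟩⟩
  have hρy : ρ = eval y p.f := by
    rw [← EReal.coe_eq_coe_iff, hρ, hval, hy.optValue_eq]
  have huy : scalarRiesz u p.f = eval y p.f := by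
    rw [← EReal.coe_eq_coe_iff, hu.2, ← hpd, hval, hy.optValue_eq]
  have hfeas := hu.1.firstOrder_mem_feasible hp
  have hfle := (hu.1.eval_firstOrder_le hp).trans_eq huy
  refine ⟨⟨hfeas, fun z hz => hfle.trans (hy.2 z hz)⟩, fun r W x hx i d v hv j => ?_⟩
  obtain ⟨h1, h2⟩ := hrep hx _ hfeas
  -- Complementary slackness: `ρ` equals the optimal value, which `f` at `firstOrder u` does not
  -- exceed, so no room is left for the nonnegative traces.
  have h3 : ∑ i, (p.PEval (firstOrder u) (x i) * W i).trace = 0 :=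
    le_antisymm (by linarith) (Finset.sum_nonneg fun i _ => h1 i)
  have h4 := (Finset.sum_eq_zero_iff_of_nonneg fun i _ => h1 i).mp h3 i (Finset.mem_univ i)
  have hP := hfeas.2 _ (x i).2
  rw [hv, Finset.mul_sum, Matrix.trace_sum] at h4
  simp_rw [trace_mul_vecMulVec_self] at h4
  -- Each summand `vᵀ P v` is zero, and a positive semidefinite form vanishes only on its kernel.
  have h5 := (Finset.sum_eq_zero_iff_of_nonneg fun j _ =>
    sum_mul_mul_nonneg_of_posSemidef hP (v j)).mp h4 j (Finset.mem_univ j)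
  rw [sum_mul_mul_eq_dotProduct] at h5
  exact (hP.dotProduct_mulVec_zero_iff (v j)).mp (by rwa [star_trivial])
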